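/- For all real constants $\varepsilon>0$ and $d\ge 1$ there is a randomized algorithm with the following property. Let $n\ge 2$ be an integer and let $\tilde G=(\tilde V,\tilde E)$ be a directed acyclic graph with $1\le|\tilde V|\le n$, given, together with $n$, as a list of its edges in arbitrary order. For $v\in\tilde V$ let $A(v)=\{u\in\tilde V:\text{there is a directed path (possibly of length }0)\text{ from }u\text{ to }v\}$ be the set of ancestors of $v$, including $v$ itself, and let $E(v)=\{(x,y)\in\tilde E: x,y\in A(v)\}$ be the set of edges of the subgraph induced by $A(v)$. On a word RAM with words of $O(\log n)$ bits, which can draw a uniformly random word in one step, the algorithm always halts within $O\big((|\tilde V|+|\tilde E|)\log^2 n\big)$ steps and returns integers $\hat a(v)$ and $\hat e(v)$ for every $v\in\tilde V$ such that, with probability at least $1-\frac1{n^d}$, simultaneously for all $v\in\tilde V$, $$(1-\varepsilon)\,|A(v)|\le \hat a(v)\le(1+\varepsilon)\,|A(v)|\quad\text{and}\quad(1-\varepsilon)\,|E(v)|\le\hat e(v)\le(1+\varepsilon)\,|E(v)|.$$ The constants hidden in the $O$-notation depend only on $\varepsilon$ and $d$. -/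

import Mathlib

/-! ### A randomized word RAM with a step count

Words of length `w` are the natural numbers below `2 ^ w`. A program is a structured program over
registers and a word-addressed memory; every arithmetic operation, memory access, assignment,
branching decision and draw of a random word costs one step. -/

namespace WordRAM

/-- The binary operations of the machine. -/
inductive BinOp where
  | add | sub | mul | div | mod | land | lor | lxor | shl | shr | lt | eq

/-- Value of a binary operation on words of length `w`: arithmetic is modulo `2 ^ w`, division by
`0` returns `0`, the remainder modulo `0` is the dividend, comparisons return `1` or `0`. -/
def BinOp.apply (w : ℕ) : BinOp → ℕ → ℕ → ℕ
  | .add, a, b => (a + b) % 2 ^ w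
  | .sub, a, b => (a + 2 ^ w - b) % 2 ^ w
  | .mul, a, b => (a * b) % 2 ^ w
  | .div, a, b => a / b
  | .mod, a, b => a % b
  | .land, a, b => a &&& b
  | .lor, a, b => a ||| b
  | .lxor, a, b => a ^^^ b
  | .shl, a, b => (a <<< b) % 2 ^ w
  | .shr, a, b => a >>> b
  | .lt, a, b => if a < b then 1 else 0
  | .eq, a, b => if a = b then 1 else 0

/-- Expressions: a constant, the content of a register, the content of the memory cell whose
address is the value of an expression, or a binary operation. -/
inductive Expr where
  | const (k : ℕ)
  | reg (i : ℕ)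
  | load (address : Expr)
  | bin (op : BinOp) (e₁ e₂ : Expr)

/-- A configuration: registers, memory, and the number of random words drawn so far. -/
structure State where
  regs : ℕ → ℕ
  mem : ℕ → ℕ
  drawn : ℕ

/-- Value of an expression. -/
def Expr.value (w : ℕ) (s : State) : Expr → ℕ
  | .const k => k % 2 ^ w
  | .reg i => s.regs i
  | .load e => s.mem (e.value w s)
  | .bin op e₁ e₂ => op.apply w (e₁.value w s) (e₂.value w s)

/-- Number of steps needed to evaluate an expression: one for each of its nodes. -/
def Expr.cost : Expr → ℕ
  | .const _ => 1
  | .reg _ => 1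
  | .load e => e.cost + 1
  | .bin _ e₁ e₂ => e₁.cost + e₂.cost + 1

/-- Programs. -/
inductive Prog where
  | skip
  | assign (i : ℕ) (e : Expr)
  | store (address e : Expr)
  | random (i : ℕ)
  | seq (p q : Prog)
  | cond (b : Expr) (p q : Prog)
  | loop (b : Expr) (p : Prog)

/-- `Exec w ω p s T t`: with word length `w` and random words `ω 0, ω 1, …`, the program `p`
started in configuration `s` halts after exactly `T` steps in configuration `t`. The instruction
`cond b p q` runs `p` if `b` has a nonzero value and `q` otherwise, `loop b p` runs `p` as long as
`b` has a nonzero value, and `random i` puts the next random word into register `i`. -/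
inductive Exec (w : ℕ) (ω : ℕ → Fin (2 ^ w)) : Prog → State → ℕ → State → Prop
  | skip (s : State) : Exec w ω .skip s 1 s
  | assign (i : ℕ) (e : Expr) (s : State) :
      Exec w ω (.assign i e) s (e.cost + 1)
        { s with regs := Function.update s.regs i (e.value w s) }
  | store (a e : Expr) (s : State) :
      Exec w ω (.store a e) s (a.cost + e.cost + 1)
        { s with mem := Function.update s.mem (a.value w s) (e.value w s) }
  | random (i : ℕ) (s : State) :
      Exec w ω (.random i) s 1
        { s with regs := Function.update s.regs i (ω s.drawn : ℕ), drawn := s.drawn + 1 }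
  | seq {p q : Prog} {s t u : State} {T₁ T₂ : ℕ} :
      Exec w ω p s T₁ t → Exec w ω q t T₂ u → Exec w ω (.seq p q) s (T₁ + T₂) u
  | condTrue {b : Expr} {p q : Prog} {s t : State} {T : ℕ} :
      b.value w s ≠ 0 → Exec w ω p s T t → Exec w ω (.cond b p q) s (b.cost + 1 + T) t
  | condFalse {b : Expr} {p q : Prog} {s t : State} {T : ℕ} :
      b.value w s = 0 → Exec w ω q s T t → Exec w ω (.cond b p q) s (b.cost + 1 + T) t
  | loopTrue {b : Expr} {p : Prog} {s t u : State} {T₁ T₂ : ℕ} :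
      b.value w s ≠ 0 → Exec w ω p s T₁ t → Exec w ω (.loop b p) t T₂ u →
      Exec w ω (.loop b p) s (b.cost + 1 + T₁ + T₂) u
  | loopFalse {b : Expr} {p : Prog} {s : State} :
      b.value w s = 0 → Exec w ω (.loop b p) s (b.cost + 1) s

/-- The law of a sequence of independent uniformly distributed random words of length `w`. -/
noncomputable def randomWords (w : ℕ) : MeasureTheory.Measure (ℕ → Fin (2 ^ w)) :=
  MeasureTheory.Measure.infinitePi fun _ : ℕ => (PMF.uniformOfFintype (Fin (2 ^ w))).toMeasure

/-- The configuration in which the cells `0, 1, 2, …` of the memory hold the words of the list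
`input` and all other cells and all registers are `0`. -/
def initial (w : ℕ) (input : List ℕ) : State where
  regs := fun _ => 0
  mem := fun i => input.getD i 0 % 2 ^ w
  drawn := 0

end WordRAM

/-! ### Directed acyclic graphs, ancestors and induced edges -/

namespace Digraph

/-- No directed closed walk of positive length. -/
def IsDAG {V : Type*} (G : Digraph V) : Prop :=
  ∀ v, ¬ Relation.TransGen G.Adj v v

/-- The ancestors of `v`, including `v` itself. -/
def ancestors {V : Type*} (G : Digraph V) (v : V) : Set V :=
  {u | Relation.ReflTransGen G.Adj u v}

/-- The edges of the subgraph induced by the ancestors of `v`. -/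
def ancestorEdges {V : Type*} (G : Digraph V) (v : V) : Set (V × V) :=
  {e | G.Adj e.1 e.2 ∧ e.1 ∈ G.ancestors v ∧ e.2 ∈ G.ancestors v}

/-- `L` lists every edge of `G` exactly once, in an arbitrary order. -/
def IsEdgeList {V : Type*} (G : Digraph V) (L : List (V × V)) : Prop :=
  L.Nodup ∧ ∀ u v, (u, v) ∈ L ↔ G.Adj u v

end Digraph

/-- The input of the algorithm: the numbers `n`, `|V|` and `|E|`, followed by the two end points
(tail, then head) of each edge. The vertices are `0, …, N - 1`. -/
def encodeInput (n N : ℕ) (L : List (Fin N × Fin N)) : List ℕ :=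
  n :: N :: L.length :: L.flatMap fun e => [(e.1 : ℕ), (e.2 : ℕ)]

/-- `x` is an estimate of `a` up to a factor `1 ± ε`. -/
def IsEstimate (ε : ℝ) (a x : ℕ) : Prop :=
  (1 - ε) * a ≤ x ∧ x ≤ (1 + ε) * a

/-- The content `t` of the machine at the end of a run is a correct output for `G`: register `0`
holds the address of an array with an estimate of the number of ancestors of each vertex, and
register `1` the address of an array with an estimate of the number of edges that they induce. -/
def CorrectOutput (ε : ℝ) {N : ℕ} (G : Digraph (Fin N)) (t : WordRAM.State) : Prop :=
  ∀ v : Fin N,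
    IsEstimate ε (G.ancestors v).ncard (t.mem (t.regs 0 + v)) ∧
    IsEstimate ε (G.ancestorEdges v).ncard (t.mem (t.regs 1 + v))

/-! Both quantities are numbers of items whose owner reaches `v`: for |A(v)| the items are the
vertices, each its own owner; for |E(v)| they are the edges, each owned by its head, since the tail
of an edge is an ancestor of `v` as soon as the head is.

If each of the `k` items reaching `v` is sampled independently with probability 2^(-i), some sampled
item reaches `v` with probability q = 1 - (1 - 2^(-i))^k, and q is close to x = k / 2^i when it is
small: q ≤ x and x (1 - q) ≤ q. One round of sampling is evaluated for all `v` at once by pushing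
one-bit marks along the edges in topological order, in linear time. With Θ(log n) repetitions on
each of Θ(log n) levels `i`, this costs O((|V| + |E|) log² n).

Put δ = 1 / D with D at least 40 / ε, and suppose that all empirical frequencies are within δ² of
their probabilities. At the largest level whose frequency is at least δ, q lies between δ / 2 and
4δ, because one level further q drops at most by a factor 2. There the frequency times 2^i has
relative error at most 10δ ≤ ε / 4, and rounding to an integer costs at most the rest of ε
(`isEstimate_levelEstimate`). If no level qualifies, then k = 0.

For a fixed level and vertex the repetitions use disjoint blocks of random words, so Hoeffding's
inequality applies (`measureReal_hitCount_deviation_le`); a union bound over levels, vertices and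
the two kinds of items needs no further independence. The positions of the words used are the same
in every run.

On the machine side, `Run` combines execution, a time bound and a postcondition. Kahn's algorithm
gives the order of the edges (`KahnInv.isTopOrder`), `IsTopOrder.hitUpTo_last` identifies propagated
marks with reachability, `EstSetup.run_estimate` evaluates an estimation phase, and `run_algorithm`
expresses the output as a deterministic function of the random words. -/

namespace WordRAM

/-! ### Runs with a time bound and a postcondition -/

/-- The configuration with the content of register `i` replaced by `x`. -/
def State.setReg (s : State) (i x : ℕ) : State := { s with regs := Function.update s.regs i x }

/-- The configuration with the content of the memory cell `a` replaced by `x`. -/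
def State.setMem (s : State) (a x : ℕ) : State := { s with mem := Function.update s.mem a x }

/-- The configuration after the draw of a random word `x` into register `i`. -/
def State.draw (s : State) (i x : ℕ) : State :=
  { s with regs := Function.update s.regs i x, drawn := s.drawn + 1 }

@[simp] theorem State.setReg_regs (s : State) (i x j : ℕ) :
    (s.setReg i x).regs j = if j = i then x else s.regs j := by
  simp [State.setReg, Function.update_apply]
@[simp] theorem State.setReg_mem (s : State) (i x : ℕ) : (s.setReg i x).mem = s.mem := rfl
@[simp] theorem State.setReg_drawn (s : State) (i x : ℕ) : (s.setReg i x).drawn = s.drawn := rfl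
@[simp] theorem State.setMem_regs (s : State) (i x : ℕ) : (s.setMem i x).regs = s.regs := rfl
@[simp] theorem State.setMem_drawn (s : State) (i x : ℕ) : (s.setMem i x).drawn = s.drawn := rfl
@[simp] theorem State.draw_regs (s : State) (i x j : ℕ) :
    (s.draw i x).regs j = if j = i then x else s.regs j := by
  simp [State.draw, Function.update_apply]
@[simp] theorem State.draw_mem (s : State) (i x : ℕ) : (s.draw i x).mem = s.mem := rfl
@[simp] theorem State.draw_drawn (s : State) (i x : ℕ) : (s.draw i x).drawn = s.drawn + 1 := rfl

/-- Entry `x` of array `k`; the arrays are consecutive blocks of `S` memory cells. -/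
def State.arr (s : State) (S k x : ℕ) : ℕ := s.mem (k * S + x)

@[simp] theorem State.setReg_arr (s : State) (i x : ℕ) : (s.setReg i x).arr = s.arr := rfl
@[simp] theorem State.draw_arr (s : State) (i x : ℕ) : (s.draw i x).arr = s.arr := rfl

/-- Since offsets stay below the block length `S`, quotient and remainder by `S` recover the array
and the index, so distinct entries never share a cell. -/
theorem State.setMem_arr (s : State) {S k k' x x' v : ℕ} (hx : x < S) (hx' : x' < S) :
    (s.setMem (k * S + x) v).arr S k' x' = if k' = k ∧ x' = x then v else s.arr S k' x' := by
  have key : k' * S + x' = k * S + x ↔ k' = k ∧ x' = x := by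
    constructor
    · intro h
      have h1 : (x' + S * k') / S = (x + S * k) / S := by
        rw [show x' + S * k' = x + S * k by linarith]
      rw [Nat.add_mul_div_left _ _ (by omega), Nat.add_mul_div_left _ _ (by omega),
        Nat.div_eq_of_lt hx, Nat.div_eq_of_lt hx'] at h1
      have h2 : k' = k := by omega
      subst h2
      exact ⟨rfl, by omega⟩
    · rintro ⟨rfl, rfl⟩; rfl
  simp [State.arr, State.setMem, Function.update_apply, key]

variable {w : ℕ} {ω : ℕ → Fin (2 ^ w)}

/-- The program halts within `B` steps in a configuration that satisfies `Q`. -/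
def Run (w : ℕ) (ω : ℕ → Fin (2 ^ w)) (p : Prog) (s : State) (B : ℕ) (Q : State → Prop) : Prop :=
  ∃ T t, Exec w ω p s T t ∧ T ≤ B ∧ Q t

theorem Run.mono {p : Prog} {s : State} {B B' : ℕ} {Q Q' : State → Prop} (h : Run w ω p s B Q)
    (hB : B ≤ B') (hQ : ∀ t, Q t → Q' t) : Run w ω p s B' Q' := by
  obtain ⟨T, t, h1, h2, h3⟩ := h
  exact ⟨T, t, h1, h2.trans hB, hQ t h3⟩

theorem Run.skip {s : State} {B : ℕ} {Q : State → Prop} (h : Q s) (hB : 1 ≤ B) :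
    Run w ω .skip s B Q := ⟨1, s, .skip s, hB, h⟩

theorem Run.assign {i : ℕ} {e : Expr} {s : State} {x B : ℕ} {Q : State → Prop}
    (he : e.value w s = x) (h : Q (s.setReg i x)) (hB : e.cost + 1 ≤ B) :
    Run w ω (.assign i e) s B Q := by
  subst he
  exact ⟨_, _, .assign i e s, hB, h⟩

theorem Run.store {a e : Expr} {s : State} {x y B : ℕ} {Q : State → Prop}
    (ha : a.value w s = y) (he : e.value w s = x) (h : Q (s.setMem y x))
    (hB : a.cost + e.cost + 1 ≤ B) : Run w ω (.store a e) s B Q := by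
  subst he ha
  exact ⟨_, _, .store a e s, hB, h⟩

theorem Run.random {i : ℕ} {s : State} {B : ℕ} {Q : State → Prop}
    (h : Q (s.draw i (ω s.drawn))) (hB : 1 ≤ B) : Run w ω (.random i) s B Q :=
  ⟨1, _, .random i s, hB, h⟩

/-- In the style of weakest preconditions: the postcondition of `p` is that `q` runs as desired, so
that intermediate configurations need no separate description. -/
theorem Run.seq {p q : Prog} {s : State} {B₁ B₂ B : ℕ} {Q : State → Prop}
    (h : Run w ω p s B₁ fun t => Run w ω q t B₂ Q) (hB : B₁ + B₂ ≤ B) :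
    Run w ω (.seq p q) s B Q := by
  obtain ⟨T, t, h1, h2, T', t', h3, h4, h5⟩ := h
  exact ⟨T + T', t', .seq h1 h3, by omega, h5⟩

theorem Run.cond {b : Expr} {p q : Prog} {s : State} {B B' : ℕ} {Q : State → Prop}
    (h1 : b.value w s ≠ 0 → Run w ω p s B Q) (h2 : b.value w s = 0 → Run w ω q s B Q)
    (hB : b.cost + 1 + B ≤ B') : Run w ω (.cond b p q) s B' Q := by
  by_cases hb : b.value w s = 0
  · obtain ⟨T, t, h3, h4, h5⟩ := h2 hb
    exact ⟨_, t, .condFalse hb h3, by omega, h5⟩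
  · obtain ⟨T, t, h3, h4, h5⟩ := h1 hb
    exact ⟨_, t, .condTrue hb h3, by omega, h5⟩

/-- A loop whose invariant carries a bound `k` on the number of remaining iterations. -/
theorem Run.loop {b : Expr} {p : Prog} {B : ℕ} {Q : State → Prop} (Inv : ℕ → State → Prop)
    (step : ∀ k t, Inv k t → b.value w t ≠ 0 →
      Run w ω p t B fun u => ∃ k' < k, Inv k' u)
    (done : ∀ k t, Inv k t → b.value w t = 0 → Q t) {k B' : ℕ} {s : State} (h : Inv k s)
    (hB : k * (B + b.cost + 1) + b.cost + 1 ≤ B') : Run w ω (.loop b p) s B' Q := by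
  suffices h : ∀ k s, Inv k s → Run w ω (.loop b p) s (k * (B + b.cost + 1) + b.cost + 1) Q from
    (h k s ‹_›).mono hB fun _ => id
  clear h hB s k
  intro k
  induction k using Nat.strong_induction_on with
  | _ k ih =>
  intro s h
  by_cases hb : b.value w s = 0
  · exact ⟨_, s, .loopFalse hb, by omega, done k s h hb⟩
  · obtain ⟨T, t, h1, h2, k', hk', h3⟩ := step k s h hb
    obtain ⟨T', t', h4, h5, h6⟩ := ih k' hk' t h3
    refine ⟨_, t', .loopTrue hb h1 h4, ?_, h6⟩
    have : (k' + 1) * (B + b.cost + 1) ≤ k * (B + b.cost + 1) := Nat.mul_le_mul_right _ hk'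
    nlinarith

/-- Run `body` with register `i` counting from `0` up to the content of register `b`. -/
def Prog.count (i b : ℕ) (body : Prog) : Prog :=
  .seq (.assign i (.const 0)) (.loop (.bin .lt (.reg i) (.reg b))
    (.seq body (.assign i (.bin .add (.reg i) (.const 1)))))

/-- The invariant is demanded after the increment of the counter, so the caller never treats the
counting itself. Per pass, 8 is 4 steps for the increment and 4 for the test; the final 6 is 2 for
the initialization and 4 for the failing test. -/
theorem Run.count {i b : ℕ} {body : Prog} {n B B' : ℕ} {s : State} {Q : State → Prop}
    (Inv : ℕ → State → Prop) (hib : b ≠ i) (hn : n < 2 ^ w) (hb : s.regs b = n)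
    (h0 : Inv 0 (s.setReg i 0))
    (step : ∀ k < n, ∀ t, Inv k t → t.regs i = k → Run w ω body t B fun u =>
      u.regs i = k ∧ u.regs b = t.regs b ∧ Inv (k + 1) (u.setReg i (k + 1)))
    (done : ∀ t, Inv n t → Q t) (hB : n * (B + 8) + 6 ≤ B') :
    Run w ω (.count i b body) s B' Q := by
  refine Run.seq (B₁ := 2) (B₂ := n * (B + 8) + 4) ?_ (by omega)
  refine Run.assign (x := 0) (by simp [Expr.value]) ?_ (by simp [Expr.cost])
  refine Run.loop (B := B + 4)
    (fun k t => k ≤ n ∧ Inv (n - k) t ∧ t.regs i = n - k ∧ t.regs b = n) ?_ ?_ (k := n) ?_ ?_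
  · rintro k t ⟨hk, h1, h2, h3⟩ h4
    have hk0 : 0 < k := by
      simp only [Expr.value, BinOp.apply, h2, h3] at h4
      split_ifs at h4 <;> omega
    refine Run.seq (B₁ := B) (B₂ := 4) ((step (n - k) (by omega) t h1 h2).mono le_rfl ?_) le_rfl
    rintro u ⟨h5, h6, h7⟩
    refine Run.assign (x := n - k + 1) ?_ ⟨k - 1, by omega, by omega, ?_, ?_, ?_⟩
      (by simp [Expr.cost])
    · simp only [Expr.value, BinOp.apply, h5]
      rw [Nat.mod_eq_of_lt (a := 1) (by omega), Nat.mod_eq_of_lt (by omega)]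
    · rwa [show n - (k - 1) = n - k + 1 by omega]
    · simp; omega
    · simp [hib, h6, h3]
  · rintro k t ⟨hk, h1, h2, h3⟩ h4
    have hk0 : k = 0 := by
      simp only [Expr.value, BinOp.apply, h2, h3] at h4
      split_ifs at h4; omega
    subst hk0
    exact done t (by simpa using h1)
  · simp [hib, hb, h0]
  · simp only [Expr.cost]
    rw [show B + 4 + (1 + 1 + 1) + 1 = B + 8 by ring]

/-! ### Values of expressions -/

section Values

variable {s : State} {e e₁ e₂ : Expr} {a b : ℕ}

theorem value_const {k : ℕ} (h : k < 2 ^ w) : (Expr.const k).value w s = k := Nat.mod_eq_of_lt h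

/-- Here and below the side conditions exclude wrap-around modulo `2 ^ w`, so machine arithmetic
agrees with that of natural numbers. -/
theorem value_add (h1 : e₁.value w s = a) (h2 : e₂.value w s = b) (h : a + b < 2 ^ w) :
    (Expr.bin .add e₁ e₂).value w s = a + b := by
  simp [Expr.value, BinOp.apply, h1, h2, Nat.mod_eq_of_lt h]

theorem value_sub (h1 : e₁.value w s = a) (h2 : e₂.value w s = b) (hab : b ≤ a) (h : a < 2 ^ w) :
    (Expr.bin .sub e₁ e₂).value w s = a - b := by
  simp only [Expr.value, BinOp.apply, h1, h2]
  rw [show a + 2 ^ w - b = (a - b) + 2 ^ w by omega, Nat.add_mod_right, Nat.mod_eq_of_lt (by omega)]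

theorem value_mul (h1 : e₁.value w s = a) (h2 : e₂.value w s = b) (h : a * b < 2 ^ w) :
    (Expr.bin .mul e₁ e₂).value w s = a * b := by
  simp [Expr.value, BinOp.apply, h1, h2, Nat.mod_eq_of_lt h]

theorem value_shl_one (h1 : e.value w s = a) (h0 : 0 < w) (h : a < w) :
    (Expr.bin .shl (.const 1) e).value w s = 2 ^ a := by
  have : 1 < 2 ^ w := Nat.one_lt_two_pow h0.ne'
  have h2 : 2 ^ a < 2 ^ w := Nat.pow_lt_pow_right (by norm_num) h
  simp [Expr.value, BinOp.apply, h1, Nat.mod_eq_of_lt this, Nat.shiftLeft_eq, Nat.mod_eq_of_lt h2]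

/-- The address of an entry of array `k`, with the block length in register `2`. -/
def Expr.adr (k : ℕ) (e : Expr) : Expr := .bin .add (.bin .mul (.const k) (.reg 2)) e

/-- An entry of array `k`. -/
def Expr.ld (k : ℕ) (e : Expr) : Expr := .load (.adr k e)

variable {S k x : ℕ}

theorem value_adr (hS : 16 * S ≤ 2 ^ w) (hs : s.regs 2 = S) (hk : k < 16)
    (he : e.value w s = x) (hx : x < S) : (Expr.adr k e).value w s = k * S + x := by
  have h1 : (k + 1) * S ≤ 16 * S := Nat.mul_le_mul_right _ hk
  have h2 : k * S + S ≤ 2 ^ w := by linarith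
  exact value_add (value_mul (value_const (by omega)) hs (by omega)) he (by omega)

theorem value_ld (hS : 16 * S ≤ 2 ^ w) (hs : s.regs 2 = S) (hk : k < 16)
    (he : e.value w s = x) (hx : x < S) : (Expr.ld k e).value w s = s.arr S k x := by
  simp [Expr.ld, Expr.value, value_adr hS hs hk he hx, State.arr]

end Values

end WordRAM

/-! ### Topological sorting -/

/-- There is an edge from `x` to `y` in the graph whose edges are the pairs `(T k, H k)`, `k < m`. -/
def EdgeRel (T H : ℕ → ℕ) (m x y : ℕ) : Prop := ∃ k < m, T k = x ∧ H k = y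

/-- One plus the largest `j < k` with `T j = u`, or `0` if there is no such `j`. -/
def lastOut (T : ℕ → ℕ) (u : ℕ) : ℕ → ℕ
  | 0 => 0
  | k + 1 => if T k = u then k + 1 else lastOut T u k

theorem lastOut_le (T : ℕ → ℕ) (u k : ℕ) : lastOut T u k ≤ k := by
  induction k with
  | zero => simp [lastOut]
  | succ k ih => simp only [lastOut]; split_ifs <;> omega

theorem lastOut_eq {T : ℕ → ℕ} {u k : ℕ} (h : lastOut T u k ≠ 0) :
    T (lastOut T u k - 1) = u := by
  induction k with
  | zero => simp [lastOut] at h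
  | succ k ih =>
    by_cases hk : T k = u
    · simp [lastOut, hk]
    · simp only [lastOut, hk, if_false] at h ⊢
      exact ih h

/-- Iterating `lastOut` runs through the outgoing edges of a vertex in decreasing order; this says
that none is skipped. The shift by one frees the value 0 for the end of the list. -/
theorem lt_lastOut {T : ℕ → ℕ} {u k j : ℕ} (hj : j < k) (hT : T j = u) : j < lastOut T u k := by
  induction k with
  | zero => omega
  | succ k ih =>
    by_cases hk : T k = u
    · simp [lastOut, hk]; omega
    · simp only [lastOut, hk, if_false]
      refine ih ?_
      rcases Nat.lt_succ_iff_lt_or_eq.1 hj with h | rfl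
      · exact h
      · exact absurd hT hk

/-- `σ 0, …, σ (m - 1)` is an enumeration of the edges in which every edge comes after all edges
into its tail. -/
structure IsTopOrder (T H : ℕ → ℕ) (m : ℕ) (σ : ℕ → ℕ) : Prop where
  lt : ∀ k < m, σ k < m
  surj : ∀ f < m, ∃ k < m, σ k = f
  before : ∀ k < m, ∀ f < m, H f = T (σ k) → ∃ j < k, σ j = f

/-- The number of edges into `v` that are not among `σ 0, …, σ (out - 1)`. -/
def pendingIn (H : ℕ → ℕ) (m : ℕ) (σ : ℕ → ℕ) (out v : ℕ) : ℕ :=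
  ((Finset.range m).filter fun f => H f = v ∧ ∀ k < out, σ k ≠ f).card

/-- The state of Kahn's algorithm: `out` edges have been listed in `σ`, the vertices without
pending incoming edges are queued in `Q 0, …, Q (qt - 1)`, the first `qh` of them have been
removed from the queue, and of the last of these the outgoing edges before edge `e` are still to be
listed. -/
structure KahnInv (T H : ℕ → ℕ) (N m : ℕ) (deg Q σ : ℕ → ℕ) (qh qt e out : ℕ) : Prop where
  σ_lt : ∀ k < out, σ k < m
  σ_inj : ∀ k < out, ∀ j < out, σ k = σ j → k = j
  deg_eq : ∀ v < N, deg v = pendingIn H m σ out v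
  Q_lt : ∀ p < qt, Q p < N
  Q_inj : ∀ p < qt, ∀ q < qt, Q p = Q q → p = q
  Q_iff : ∀ v < N, deg v = 0 ↔ ∃ p < qt, Q p = v
  listed : ∀ f < m, (∃ k < out, σ k = f) ↔
    (∃ p, p + 1 < qh ∧ Q p = T f) ∨ (0 < qh ∧ Q (qh - 1) = T f ∧ e ≤ f)
  cur : e ≠ 0 → 0 < qh ∧ e ≤ m ∧ T (e - 1) = Q (qh - 1)
  before : ∀ k < out, ∀ f < m, H f = T (σ k) → ∃ j < k, σ j = f
  qh_le : qh ≤ qt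

/-! ### Preservation of the invariant of Kahn's algorithm, and its conclusion. -/

section Kahn

variable {T H : ℕ → ℕ} {N m : ℕ} {deg Q σ : ℕ → ℕ} {qh qt e out : ℕ}

theorem pendingIn_eq_zero {v : ℕ} :
    pendingIn H m σ out v = 0 ↔ ∀ f < m, H f = v → ∃ k < out, σ k = f := by
  simp [pendingIn, Finset.filter_eq_empty_iff]

theorem pendingIn_congr {σ' : ℕ → ℕ} (h : ∀ k < out, σ' k = σ k) (v : ℕ) :
    pendingIn H m σ' out v = pendingIn H m σ out v := by
  unfold pendingIn
  congr 1
  refine Finset.filter_congr fun f _ => ?_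
  refine and_congr Iff.rfl (forall_congr' fun k => forall_congr' fun hk => by rw [h k hk])

/-- A newly listed edge leaves the pending set of its head and of no other vertex, so decrementing
one in-degree keeps all of them correct. -/
theorem pendingIn_succ (hlt : σ out < m) (hnew : ∀ k < out, σ k ≠ σ out) (v : ℕ) :
    pendingIn H m σ out v = pendingIn H m σ (out + 1) v + if H (σ out) = v then 1 else 0 := by
  unfold pendingIn
  split_ifs with hv
  · rw [← Finset.card_insert_of_notMem (a := σ out)]
    · congr 1
      ext f
      simp only [Finset.mem_filter, Finset.mem_range, Finset.mem_insert]
      constructor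
      · rintro ⟨h1, h2, h3⟩
        by_cases hf : f = σ out
        · exact .inl hf
        · refine .inr ⟨h1, h2, fun k hk => ?_⟩
          rcases Nat.lt_succ_iff_lt_or_eq.1 hk with h | rfl
          · exact h3 k h
          · exact fun h => hf h.symm
      · rintro (rfl | ⟨h1, h2, h3⟩)
        · exact ⟨hlt, hv, hnew⟩
        · exact ⟨h1, h2, fun k hk => h3 k (by omega)⟩
    · simp only [Finset.mem_filter, not_and]
      exact fun _ _ h => h out (by omega) rfl
  · rw [add_zero]
    congr 1
    refine Finset.filter_congr fun f _ => ?_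
    refine and_congr_right fun h1 => ⟨fun h k hk => ?_, fun h k hk => h k (by omega)⟩
    rcases Nat.lt_succ_iff_lt_or_eq.1 hk with h' | rfl
    · exact h k h'
    · rintro rfl; exact hv h1

theorem KahnInv.init (hdeg : ∀ v < N, deg v = ((Finset.range m).filter fun f => H f = v).card)
    (h1 : ∀ p < qt, Q p < N) (h2 : ∀ p < qt, ∀ q < qt, Q p = Q q → p = q)
    (h3 : ∀ v < N, deg v = 0 ↔ ∃ p < qt, Q p = v) : KahnInv T H N m deg Q σ 0 qt 0 0 where
  σ_lt := by simp
  σ_inj := by simp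
  deg_eq v hv := by simp [hdeg v hv, pendingIn]
  Q_lt := h1
  Q_inj := h2
  Q_iff := h3
  listed := by simp
  cur := by simp
  before := by simp
  qh_le := by simp

/-- Removing a vertex from the queue. -/
theorem KahnInv.pop (h : KahnInv T H N m deg Q σ qh qt 0 out) (hq : qh < qt) :
    KahnInv T H N m deg Q σ (qh + 1) qt (lastOut T (Q qh) m) out where
  σ_lt := h.σ_lt
  σ_inj := h.σ_inj
  deg_eq := h.deg_eq
  Q_lt := h.Q_lt
  Q_inj := h.Q_inj
  Q_iff := h.Q_iff
  listed f hf := by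
    rw [h.listed f hf]
    constructor
    · rintro (⟨p, hp, h1⟩ | ⟨h0, h1, -⟩)
      · exact .inl ⟨p, by omega, h1⟩
      · exact .inl ⟨qh - 1, by omega, h1⟩
    · rintro (⟨p, hp, h1⟩ | ⟨-, h1, h2⟩)
      · by_cases hpq : p + 1 < qh
        · exact .inl ⟨p, hpq, h1⟩
        · exact .inr ⟨by omega, by rw [← h1]; congr 1; omega, by omega⟩
      -- All outgoing edges of the popped vertex lie below the new `e`, so none of them counts as
      -- listed yet.
      · exact absurd (lt_lastOut hf h1.symm) (by simpa using h2)
  cur he := ⟨by omega, lastOut_le _ _ _, by simpa using lastOut_eq he⟩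
  before := h.before
  qh_le := hq

/-- Listing an edge, before the queue is updated. -/
theorem KahnInv.emit_aux (h : KahnInv T H N m deg Q σ qh qt e out) (he : e ≠ 0)
    (hTN : ∀ f < m, T f < N) {σ' : ℕ → ℕ} (hσ : ∀ k < out, σ' k = σ k) (hout : σ' out = e - 1) :
    (∀ k < out + 1, σ' k < m) ∧ (∀ k < out + 1, ∀ j < out + 1, σ' k = σ' j → k = j) ∧
    (∀ v < N, deg v = pendingIn H m σ' (out + 1) v + if H (e - 1) = v then 1 else 0) ∧
    (∀ f < m, (∃ k < out + 1, σ' k = f) ↔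
      (∃ p, p + 1 < qh ∧ Q p = T f) ∨
        (0 < qh ∧ Q (qh - 1) = T f ∧ lastOut T (T (e - 1)) (e - 1) ≤ f)) ∧
    (∀ k < out + 1, ∀ f < m, H f = T (σ' k) → ∃ j < k, σ' j = f) := by
  obtain ⟨hq0, hem, hT⟩ := h.cur he
  -- If edge `e - 1` were listed already, its tail would also occur earlier in the queue, against
  -- injectivity, or `e ≤ e - 1` would hold.
  have hnew : ∀ k < out, σ k ≠ e - 1 := by
    intro k hk hke
    rcases (h.listed (e - 1) (by omega)).1 ⟨k, hk, hke⟩ with ⟨p, hp, h1⟩ | ⟨-, -, h1⟩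
    · have := h.Q_inj p (by have := h.qh_le; omega) (qh - 1) (by have := h.qh_le; omega)
        (h1.trans hT)
      omega
    · omega
  have key : ∀ f, (∃ k < out + 1, σ' k = f) ↔ (∃ k < out, σ k = f) ∨ f = e - 1 := by
    intro f
    constructor
    · rintro ⟨k, hk, h1⟩
      rcases Nat.lt_succ_iff_lt_or_eq.1 hk with h' | rfl
      · exact .inl ⟨k, h', by rw [← hσ k h', h1]⟩
      · exact .inr (by rw [← h1, hout])
    · rintro (⟨k, hk, h1⟩ | rfl)
      · exact ⟨k, by omega, by rw [hσ k hk, h1]⟩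
      · exact ⟨out, by omega, hout⟩
  refine ⟨fun k hk => ?_, fun k hk j hj hkj => ?_, fun v hv => ?_, fun f hf => ?_,
    fun k hk f hf hH => ?_⟩
  · rcases Nat.lt_succ_iff_lt_or_eq.1 hk with h' | rfl
    · rw [hσ k h']; exact h.σ_lt k h'
    · omega
  · rcases Nat.lt_succ_iff_lt_or_eq.1 hk with h1 | rfl <;>
      rcases Nat.lt_succ_iff_lt_or_eq.1 hj with h2 | rfl
    · exact h.σ_inj k h1 j h2 (by rwa [hσ k h1, hσ j h2] at hkj)
    · exact absurd (by rwa [hσ k h1, hout] at hkj) (hnew k h1)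
    · exact absurd (by rw [hσ j h2, hout] at hkj; exact hkj.symm) (hnew j h2)
    · rfl
  · rw [h.deg_eq v hv, ← pendingIn_congr hσ,
      pendingIn_succ (by omega) (fun k hk => by rw [hσ k hk, hout]; exact hnew k hk), hout]
  · rw [key, h.listed f hf]
    constructor
    · rintro ((h1 | ⟨h0, h1, h2⟩) | rfl)
      · exact .inl h1
      · exact .inr ⟨h0, h1, (lastOut_le _ _ _).trans (by omega)⟩
      · exact .inr ⟨hq0, hT.symm, lastOut_le _ _ _⟩
    · rintro (h1 | ⟨h0, h1, h2⟩)
      · exact .inl (.inl h1)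
      -- An edge with the same tail below `e - 1` would lie below `lastOut`, so passing to the next
      -- list entry adds `e - 1` only.
      · rcases lt_trichotomy f (e - 1) with h3 | h3 | h3
        · exact absurd (lt_lastOut h3 (h1.symm.trans hT.symm)) (by omega)
        · exact .inr h3
        · exact .inl (.inr ⟨h0, h1, by omega⟩)
  · rcases Nat.lt_succ_iff_lt_or_eq.1 hk with h' | rfl
    · rw [hσ k h'] at hH
      obtain ⟨j, hj, h1⟩ := h.before k h' f hf hH
      exact ⟨j, hj, by rw [hσ j (by omega), h1]⟩
    · rw [hout] at hH
      -- The tail of the new edge is in the queue, so it has no pending incoming edges: every edge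
      -- into it has been listed before.
      have h0 : deg (T (e - 1)) = 0 := (h.Q_iff _ (hTN _ (by omega))).2
        ⟨qh - 1, by have := h.qh_le; omega, hT.symm⟩
      rw [h.deg_eq _ (hTN _ (by omega)), pendingIn_eq_zero] at h0
      obtain ⟨j, hj, h1⟩ := h0 f hf hH
      exact ⟨j, hj, by rw [hσ j hj, h1]⟩

/-- Listing an edge into a vertex that has further pending incoming edges. -/
theorem KahnInv.emit (h : KahnInv T H N m deg Q σ qh qt e out) (he : e ≠ 0)
    (hTN : ∀ f < m, T f < N) {σ' deg' : ℕ → ℕ}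
    (hσ : ∀ k < out, σ' k = σ k) (hout : σ' out = e - 1)
    (hdeg : ∀ v < N, deg' v = if v = H (e - 1) then deg v - 1 else deg v)
    (hne : deg' (H (e - 1)) ≠ 0) :
    KahnInv T H N m deg' Q σ' qh qt (lastOut T (T (e - 1)) (e - 1)) (out + 1) := by
  obtain ⟨a1, a2, a3, a4, a5⟩ := h.emit_aux he hTN hσ hout
  obtain ⟨hq0, hem, hT⟩ := h.cur he
  refine ⟨a1, a2, fun v hv => ?_, h.Q_lt, h.Q_inj, fun v hv => ?_, a4, fun h0 => ⟨hq0, ?_, ?_⟩, a5,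
    h.qh_le⟩
  · rw [hdeg v hv, a3 v hv]
    by_cases hv' : v = H (e - 1)
    · simp [hv']
    · simp [hv', Ne.symm hv']
  · rw [← h.Q_iff v hv]
    by_cases hv' : v = H (e - 1)
    · have := hdeg v hv
      rw [if_pos hv'] at this
      subst hv'
      omega
    · rw [hdeg v hv, if_neg hv']
  · have := lastOut_le T (T (e - 1)) (e - 1); omega
  · rw [lastOut_eq h0, hT]

/-- Listing the last pending edge into a vertex, which is put into the queue. -/
theorem KahnInv.emit_push (h : KahnInv T H N m deg Q σ qh qt e out) (he : e ≠ 0)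
    (hTN : ∀ f < m, T f < N) (hHN : ∀ f < m, H f < N) {σ' deg' Q' : ℕ → ℕ}
    (hσ : ∀ k < out, σ' k = σ k) (hout : σ' out = e - 1)
    (hdeg : ∀ v < N, deg' v = if v = H (e - 1) then deg v - 1 else deg v)
    (h0 : deg' (H (e - 1)) = 0) (hQ : ∀ p < qt, Q' p = Q p) (hQt : Q' qt = H (e - 1)) :
    KahnInv T H N m deg' Q' σ' qh (qt + 1) (lastOut T (T (e - 1)) (e - 1)) (out + 1) := by
  obtain ⟨a1, a2, a3, a4, a5⟩ := h.emit_aux he hTN hσ hout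
  obtain ⟨hq0, hem, hT⟩ := h.cur he
  have hqq := h.qh_le
  have hHe := hHN (e - 1) (by omega)
  have hpos : deg (H (e - 1)) ≠ 0 := by rw [a3 _ hHe]; simp
  have hfresh : ∀ p < qt, Q p ≠ H (e - 1) := fun p hp hpe =>
    hpos ((h.Q_iff _ hHe).2 ⟨p, hp, hpe⟩)
  refine ⟨a1, a2, fun v hv => ?_, fun p hp => ?_, fun p hp q hq hpq => ?_, fun v hv => ?_,
    fun f hf => ?_, fun h0 => ⟨hq0, ?_, ?_⟩, a5, by omega⟩
  · rw [hdeg v hv, a3 v hv]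
    by_cases hv' : v = H (e - 1)
    · simp [hv']
    · simp [hv', Ne.symm hv']
  · rcases Nat.lt_succ_iff_lt_or_eq.1 hp with h' | rfl
    · rw [hQ p h']; exact h.Q_lt p h'
    · rwa [hQt]
  · rcases Nat.lt_succ_iff_lt_or_eq.1 hp with h1 | rfl <;>
      rcases Nat.lt_succ_iff_lt_or_eq.1 hq with h2 | rfl
    · exact h.Q_inj p h1 q h2 (by rwa [hQ p h1, hQ q h2] at hpq)
    · exact absurd (by rwa [hQ p h1, hQt] at hpq) (hfresh p h1)
    · exact absurd (by rw [hQ q h2, hQt] at hpq; exact hpq.symm) (hfresh q h2)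
    · rfl
  · by_cases hv' : v = H (e - 1)
    · subst hv'
      simp only [h0, true_iff]
      exact ⟨qt, by omega, hQt⟩
    · rw [hdeg v hv, if_neg hv', h.Q_iff v hv]
      constructor
      · rintro ⟨p, hp, h1⟩
        exact ⟨p, by omega, by rw [hQ p hp, h1]⟩
      · rintro ⟨p, hp, h1⟩
        rcases Nat.lt_succ_iff_lt_or_eq.1 hp with h' | rfl
        · exact ⟨p, h', by rw [← hQ p h', h1]⟩
        · exact absurd (h1.symm.trans hQt) hv'
  · rw [a4 f hf, hQ (qh - 1) (by omega)]
    refine or_congr (exists_congr fun p => and_congr_right fun hp => ?_) Iff.rfl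
    rw [hQ p (by omega)]
  · have := lastOut_le T (T (e - 1)) (e - 1); omega
  · rw [lastOut_eq h0, hT, hQ (qh - 1) (by omega)]

/-- Pigeonhole on an injective listing. These bounds keep the array accesses in range and make the
number of remaining iterations finite. -/
theorem KahnInv.out_le (h : KahnInv T H N m deg Q σ qh qt e out) : out ≤ m := by
  have := Finset.card_le_card_of_injOn (s := Finset.range out) (t := Finset.range m) σ
    (fun k hk => by simpa using h.σ_lt k (by simpa using hk))
    (fun k hk j hj => h.σ_inj k (by simpa using hk) j (by simpa using hj))
  simpa using this

theorem KahnInv.qt_le (h : KahnInv T H N m deg Q σ qh qt e out) : qt ≤ N := by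
  have := Finset.card_le_card_of_injOn (s := Finset.range qt) (t := Finset.range N) Q
    (fun k hk => by simpa using h.Q_lt k (by simpa using hk))
    (fun k hk j hj => h.Q_inj k (by simpa using hk) j (by simpa using hj))
  simpa using this

theorem KahnInv.out_lt (h : KahnInv T H N m deg Q σ qh qt e out) (he : e ≠ 0)
    (hTN : ∀ f < m, T f < N) : out < m := by
  obtain ⟨a1, a2, -⟩ := h.emit_aux (σ' := fun k => if k = out then e - 1 else σ k) he hTN
    (fun k hk => by simp [hk.ne]) (by simp)
  have := Finset.card_le_card_of_injOn (s := Finset.range (out + 1)) (t := Finset.range m) _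
    (fun k hk => by simpa using a1 k (by simpa using hk))
    (fun k hk j hj => a2 k (by simpa using hk) j (by simpa using hj))
  simpa using this

/-- When the queue of Kahn's algorithm has become empty, an acyclic graph is sorted. -/
theorem KahnInv.isTopOrder (h : KahnInv T H N m deg Q σ qh qh 0 out)
    (hTN : ∀ f < m, T f < N) (hwf : WellFounded (EdgeRel T H m)) : IsTopOrder T H m σ := by
  -- Well-founded induction along the edges: by the hypothesis for its tail, the tail of `f` has no
  -- pending edges, so it has entered the queue; as the queue is exhausted, it was popped and its
  -- outgoing edges were listed.
  have all : ∀ v, ∀ f < m, H f = v → ∃ k < out, σ k = f := by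
    intro v
    induction v using hwf.induction with
    | _ v ih =>
    intro f hf hv
    have h0 : deg (T f) = 0 := by
      rw [h.deg_eq _ (hTN f hf), pendingIn_eq_zero]
      exact ih (T f) ⟨f, hf, rfl, hv⟩
    obtain ⟨p, hp, h1⟩ := (h.Q_iff _ (hTN f hf)).1 h0
    rw [h.listed f hf]
    by_cases hpq : p + 1 < qh
    · exact .inl ⟨p, hpq, h1⟩
    · exact .inr ⟨by omega, by rw [← h1]; congr 1; omega, by omega⟩
  have hm : out = m := by
    refine le_antisymm h.out_le ?_
    choose g hg using fun f : Fin m => all _ f f.2 rfl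
    have := Fintype.card_le_of_injective (fun f : Fin m => (⟨g f, (hg f).1⟩ : Fin out))
      (fun f f' hff => by
        have : g f = g f' := by simpa using hff
        exact Fin.ext (by rw [← (hg f).2, ← (hg f').2, this]))
    simpa using this
  subst hm
  exact ⟨h.σ_lt, fun f hf => all _ f hf rfl, h.before⟩

end Kahn

/-! ### Propagation of marks -/

section Propagation

variable {T H σ : ℕ → ℕ} {m : ℕ} {p : ℕ → Prop}

/-- Some vertex with property `p` reaches `v`. -/
def HitFrom (T H : ℕ → ℕ) (m : ℕ) (p : ℕ → Prop) (v : ℕ) : Prop :=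
  ∃ u, p u ∧ Relation.ReflTransGen (EdgeRel T H m) u v

/-- The vertices marked when the marks `p` have been propagated along the first `k` edges. -/
def HitUpTo (T H : ℕ → ℕ) (m : ℕ) (σ : ℕ → ℕ) (p : ℕ → Prop) (k v : ℕ) : Prop :=
  p v ∨ ∃ j < k, H (σ j) = v ∧ HitFrom T H m p (T (σ j))

theorem hitFrom_iff {v : ℕ} :
    HitFrom T H m p v ↔ p v ∨ ∃ f < m, H f = v ∧ HitFrom T H m p (T f) := by
  constructor
  · rintro ⟨u, hu, h⟩
    rcases Relation.ReflTransGen.cases_tail h with rfl | ⟨x, h1, f, hf, rfl, h2⟩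
    · exact .inl hu
    · exact .inr ⟨f, hf, h2, u, hu, h1⟩
  · rintro (h | ⟨f, hf, rfl, u, hu, h⟩)
    · exact ⟨v, h, .refl⟩
    · exact ⟨u, hu, h.tail ⟨f, hf, rfl, rfl⟩⟩

theorem hitUpTo_zero {v : ℕ} : HitUpTo T H m σ p 0 v ↔ p v := by simp [HitUpTo]

/-- All edges into the tail precede the current edge, so the mark of the tail is already final when
it is read. This is the only place where a prefix of the order suffices. -/
theorem IsTopOrder.hitUpTo_tail (h : IsTopOrder T H m σ) {k : ℕ} (hk : k < m) :
    HitUpTo T H m σ p k (T (σ k)) ↔ HitFrom T H m p (T (σ k)) := by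
  rw [hitFrom_iff]
  refine or_congr Iff.rfl ⟨?_, ?_⟩
  · rintro ⟨j, hj, h1, h2⟩
    exact ⟨σ j, h.lt j (by omega), h1, h2⟩
  · rintro ⟨f, hf, h1, h2⟩
    obtain ⟨j, hj, rfl⟩ := h.before k hk f hf h1
    exact ⟨j, hj, h1, h2⟩

theorem IsTopOrder.hitUpTo_last (h : IsTopOrder T H m σ) {v : ℕ} :
    HitUpTo T H m σ p m v ↔ HitFrom T H m p v := by
  rw [hitFrom_iff]
  refine or_congr Iff.rfl ⟨?_, ?_⟩
  · rintro ⟨j, hj, h1, h2⟩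
    exact ⟨σ j, h.lt j hj, h1, h2⟩
  · rintro ⟨f, hf, h1, h2⟩
    obtain ⟨j, hj, rfl⟩ := h.surj f hf
    exact ⟨j, hj, h1, h2⟩

/-- `HitUpTo` is defined with full reachability of the tails; `hitUpTo_tail` replaces this by the
current mark, which is what the machine tests. -/
theorem IsTopOrder.hitUpTo_succ (h : IsTopOrder T H m σ) {k : ℕ} (hk : k < m) {v : ℕ} :
    HitUpTo T H m σ p (k + 1) v ↔
      HitUpTo T H m σ p k v ∨ (v = H (σ k) ∧ HitUpTo T H m σ p k (T (σ k))) := by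
  rw [h.hitUpTo_tail hk]
  unfold HitUpTo
  rw [or_assoc]
  refine or_congr Iff.rfl ⟨?_, ?_⟩
  · rintro ⟨j, hj, h1, h2⟩
    rcases Nat.lt_succ_iff_lt_or_eq.1 hj with h3 | rfl
    · exact .inl ⟨j, h3, h1, h2⟩
    · exact .inr ⟨h1.symm, h2⟩
  · rintro (⟨j, hj, h1, h2⟩ | ⟨h1, h2⟩)
    · exact ⟨j, by omega, h1, h2⟩
    · exact ⟨k, by omega, h1.symm, h2⟩

end Propagation

/-! ### Estimates from the numbers of hits -/

/-- The integer next to `c * 2 ^ i / R`. -/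
def scaledCount (R i c : ℕ) : ℕ := (2 * (c * 2 ^ i) + R) / (2 * R)

/-- The scaled count of the largest level `i < k` with at least `thr` hits. -/
def levelEstimate (R thr : ℕ) (c : ℕ → ℕ) : ℕ → ℕ
  | 0 => 0
  | k + 1 => if c k < thr then levelEstimate R thr c k else scaledCount R k (c k)

theorem levelEstimate_cases (R thr : ℕ) (c : ℕ → ℕ) (I : ℕ) :
    ((∀ i < I, c i < thr) ∧ levelEstimate R thr c I = 0) ∨
    ∃ i < I, thr ≤ c i ∧ (∀ j < I, i < j → c j < thr) ∧
      levelEstimate R thr c I = scaledCount R i (c i) := by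
  induction I with
  | zero => simp [levelEstimate]
  | succ k ih =>
    by_cases hk : c k < thr
    · simp only [levelEstimate, hk, if_true]
      rcases ih with ⟨h1, h2⟩ | ⟨i, hi, h1, h2, h3⟩
      · refine .inl ⟨fun i hi => ?_, h2⟩
        rcases Nat.lt_succ_iff_lt_or_eq.1 hi with h | rfl
        · exact h1 i h
        · exact hk
      · refine .inr ⟨i, by omega, h1, fun j hj hij => ?_, h3⟩
        rcases Nat.lt_succ_iff_lt_or_eq.1 hj with h | rfl
        · exact h2 j h hij
        · exact hk
    · simp only [levelEstimate, hk, if_false]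
      exact .inr ⟨k, by omega, by omega, fun j hj hij => by omega, rfl⟩

/-- The probability that at least one of `a` independent events of probability `2 ^ (-i)` occurs. -/
noncomputable def hitProb (a i : ℕ) : ℝ := 1 - (1 - 1 / 2 ^ i) ^ a

/-- The union bound, in the form of Bernoulli's inequality for (1 - p)^a. -/
theorem hitProb_le (a i : ℕ) : hitProb a i ≤ a / 2 ^ i := by
  have h : (1 : ℝ) / 2 ^ i ≤ 1 := by
    rw [div_le_one (by positivity)]; exact one_le_pow₀ (by norm_num)
  have := one_add_mul_le_pow (a := -((1 : ℝ) / 2 ^ i)) (by linarith) a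
  unfold hitProb
  rw [← sub_eq_add_neg] at this
  have h2 : (a : ℝ) / 2 ^ i = a * (1 / 2 ^ i) := by ring
  rw [h2]; linarith

/-- Bernoulli for (1 + p)^a and (1 - p)^a (1 + p)^a ≤ 1 give (1 - q)(1 + ap) ≤ 1. This is the
converse of `hitProb_le` for small q. -/
theorem div_mul_le_hitProb (a i : ℕ) : (a : ℝ) / 2 ^ i * (1 - hitProb a i) ≤ hitProb a i := by
  set p : ℝ := 1 / 2 ^ i with hp
  have h0 : 0 < p := by positivity
  have h : p ≤ 1 := by
    rw [hp, div_le_one (by positivity)]; exact one_le_pow₀ (by norm_num)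
  have h1 := one_add_mul_le_pow (a := p) (by linarith) a
  have h2 : (1 - p) ^ a * (1 + p) ^ a ≤ 1 := by
    rw [← mul_pow]
    exact pow_le_one₀ (by nlinarith) (by nlinarith)
  have h3 : 0 ≤ (1 - p) ^ a := pow_nonneg (by linarith) a
  have h4 : (1 - p) ^ a * (1 + a * p) ≤ 1 := (mul_le_mul_of_nonneg_left h1 h3).trans h2
  have h5 : (a : ℝ) / 2 ^ i = a * p := by rw [hp]; ring
  unfold hitProb
  rw [h5, ← hp]
  nlinarith

/-- Halving the sampling rate at most halves the probability of a hit, so the probability cannot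
jump past the window around the threshold between neighbouring levels. -/
theorem hitProb_le_two_mul (a i : ℕ) : hitProb a i ≤ 2 * hitProb a (i + 1) := by
  set r : ℝ := 1 / 2 ^ (i + 1) with hr
  have h0 : 0 < r := by positivity
  have h1 : (1 : ℝ) / 2 ^ i = 2 * r := by rw [hr, pow_succ]; field_simp
  have h2 : 2 * r ≤ 1 := by
    rw [← h1, div_le_one (by positivity)]; exact one_le_pow₀ (by norm_num)
  have key : 2 * (1 - r) ^ a ≤ 1 + (1 - 2 * r) ^ a := by
    induction a with
    | zero => norm_num
    | succ a ih =>
      have h3 : (1 - 2 * r) ^ a ≤ 1 := pow_le_one₀ (by linarith) (by linarith)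
      rw [pow_succ, pow_succ]
      nlinarith
  unfold hitProb
  rw [h1, ← hr]
  linarith

/-- Rounding to the next integer turns the precision `ε / 4` into the precision `ε`. -/
theorem isEstimate_scaledCount {ε : ℝ} {R i c a : ℕ} (hR : 0 < R)
    (h : |(c : ℝ) / R * 2 ^ i - a| ≤ ε / 4 * a) : IsEstimate ε a (scaledCount R i c) := by
  set z := scaledCount R i c with hz
  have hR' : (0 : ℝ) < R := by exact_mod_cast hR
  have h1 : z * (2 * R) ≤ 2 * (c * 2 ^ i) + R := Nat.div_mul_le_self _ _
  have h2 : 2 * (c * 2 ^ i) + R < (z + 1) * (2 * R) := by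
    have := Nat.lt_mul_div_succ (2 * (c * 2 ^ i) + R) (show 0 < 2 * R by omega)
    rw [mul_comm (z + 1)]; exact this
  have h1' : (z : ℝ) * (2 * R) ≤ 2 * (c * 2 ^ i) + R := by exact_mod_cast h1
  have h2' : 2 * ((c : ℝ) * 2 ^ i) + R < (z + 1) * (2 * R) := by exact_mod_cast h2
  set y : ℝ := (c : ℝ) / R * 2 ^ i with hy
  have hcy : (c : ℝ) * 2 ^ i = y * R := by rw [hy]; field_simp
  rw [hcy] at h1' h2'
  have h3 : (z : ℝ) ≤ y + 1 / 2 := by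
    by_contra hc; push Not at hc; nlinarith
  have h4 : y < z + 1 / 2 := by
    by_contra hc; push Not at hc; nlinarith
  rw [abs_le] at h
  -- Either the error before rounding is below 1/2 and rounding is exact, or the rounding error of
  -- 1/2 is itself at most `ε / 4 * a`.
  by_cases hs : ε / 4 * a < 1 / 2
  · have h5 : z = a := by
      have h6 : (z : ℝ) < a + 1 := by linarith
      have h7 : (a : ℝ) < z + 1 := by linarith
      have h6' : z < a + 1 := by exact_mod_cast h6
      have h7' : a < z + 1 := by exact_mod_cast h7
      omega
    have h8 : 0 ≤ ε / 4 * a := by linarith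
    unfold IsEstimate
    rw [h5]
    constructor <;> nlinarith
  · push Not at hs
    unfold IsEstimate
    constructor <;> nlinarith

/-- The threshold corresponds to the frequency δ = 1 / D, and the assumed additive accuracy δ² is
smaller by a factor δ, hence a relative accuracy at the chosen level. The hypothesis `ha` makes the
top level so sparse that the threshold lies above the expected frequency. -/
theorem isEstimate_levelEstimate {ε : ℝ} {D R thr I a : ℕ} {c : ℕ → ℕ} (hε : 0 < ε)
    (hD : 8 ≤ D) (hDε : 40 / ε ≤ D) (hthr : 0 < thr) (hR : R = D * thr) (hI : 0 < I)
    (ha : D * a ≤ 2 ^ (I - 1))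
    (hc : ∀ i < I, |(c i : ℝ) / R - hitProb a i| ≤ 1 / (D : ℝ) ^ 2) :
    IsEstimate ε a (levelEstimate R thr c I) := by
  have hD' : (8 : ℝ) ≤ D := by exact_mod_cast hD
  have hthr' : (0 : ℝ) < thr := by exact_mod_cast hthr
  have hR0 : 0 < R := by rw [hR]; exact Nat.mul_pos (by omega) hthr
  have hR' : (R : ℝ) = D * thr := by rw [hR]; push_cast; ring
  have hRpos : (0 : ℝ) < R := by exact_mod_cast hR0
  set δ : ℝ := 1 / D with hδ
  have hδ0 : 0 < δ := by positivity
  have hδ8 : δ ≤ 1 / 8 := one_div_le_one_div_of_le (by norm_num) hD'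
  have hδ2 : 1 / (D : ℝ) ^ 2 = δ ^ 2 := by rw [hδ]; field_simp
  have hδε : 10 * δ ≤ ε / 4 := by
    rw [div_le_iff₀ hε] at hDε
    rw [hδ, mul_one_div, div_le_div_iff₀ (by linarith) (by norm_num)]
    linarith
  have hlt : ∀ i, c i < thr → (c i : ℝ) / R < δ := by
    intro i hi
    have : (c i : ℝ) < thr := by exact_mod_cast hi
    rw [hδ, hR', div_lt_div_iff₀ (by positivity) (by positivity)]
    nlinarith
  have hge : ∀ i, thr ≤ c i → δ ≤ (c i : ℝ) / R := by
    intro i hi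
    have : (thr : ℝ) ≤ c i := by exact_mod_cast hi
    rw [hδ, hR', div_le_div_iff₀ (by positivity) (by positivity)]
    nlinarith
  rw [hδ2] at hc
  rcases levelEstimate_cases R thr c I with ⟨h1, h2⟩ | ⟨i, hi, h1, h2, h3⟩
  · rw [h2]
    -- At level 0 every item is sampled, so a positive `a` would have hit probability 1 and a
    -- frequency above δ there.
    rcases Nat.eq_zero_or_pos a with rfl | ha0
    · simp [IsEstimate]
    · have h3 := abs_le.1 (hc 0 hI)
      have h4 := hlt 0 (h1 0 hI)
      have h5 : hitProb a 0 = 1 := by simp [hitProb, ha0.ne']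
      rw [h5] at h3
      nlinarith
  · rw [h3]
    refine isEstimate_scaledCount hR0 ?_
    have hq := abs_le.1 (hc i hi)
    have hci := hge i h1
    set q := hitProb a i with hqdef
    set x : ℝ := (a : ℝ) / 2 ^ i with hx
    have hqx : q ≤ x := hitProb_le a i
    have hxq : x * (1 - q) ≤ q := div_mul_le_hitProb a i
    -- Below the top, the next level has frequency less than δ, so q ≤ 2 (δ + δ²). At the top level
    -- q ≤ x ≤ δ by `ha`.
    have hq4 : q ≤ 4 * δ := by
      by_cases hiI : i + 1 < I
      · have h4 := abs_le.1 (hc (i + 1) hiI)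
        have h5 := hlt (i + 1) (h2 (i + 1) hiI (by omega))
        have h6 := hitProb_le_two_mul a i
        rw [← hqdef] at h6
        nlinarith
      · have hiI' : I - 1 = i := by omega
        rw [hiI'] at ha
        have h4 : (D : ℝ) * a ≤ 2 ^ i := by exact_mod_cast ha
        have h5 : x ≤ δ := by
          rw [hx, hδ, div_le_div_iff₀ (by positivity) (by positivity)]
          linarith
        linarith
    have hq2 : δ / 2 ≤ q := by nlinarith
    have hx0 : 0 < x := by linarith
    -- The bias of q as a substitute for x is at most q x. With the sampling error δ² ≤ 2 δ x the
    -- total is at most 10 δ x, which explains the constant in `40 / ε`.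
    have h5 : x - q ≤ 8 * δ * x := by nlinarith
    have h6 : δ ^ 2 ≤ 2 * δ * x := by nlinarith
    have h7 : |(c i : ℝ) / R - x| ≤ ε / 4 * x := by
      rw [abs_le]
      constructor <;> nlinarith
    have h8 : (c i : ℝ) / R * 2 ^ i - a = ((c i : ℝ) / R - x) * 2 ^ i := by
      rw [hx]; field_simp
    have h9 : (a : ℝ) = x * 2 ^ i := by rw [hx]; field_simp
    rw [h8, abs_mul, abs_of_pos (by positivity : (0 : ℝ) < 2 ^ i), h9, ← mul_assoc]
    exact mul_le_mul_of_nonneg_right h7 (by positivity)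

namespace WordRAM

/-! ### The estimation phase -/

/-- The tail of the edge whose position in the topological order is in register `12`. -/
def tailExpr : Expr :=
  .ld 0 (.bin .add (.const 3) (.bin .mul (.const 2) (.ld 5 (.reg 12))))

/-- The head of the edge whose position in the topological order is in register `12`. -/
def headExpr : Expr :=
  .ld 0 (.bin .add (.const 4) (.bin .mul (.const 2) (.ld 5 (.reg 12))))

/-- Draw a word for every item and mark the owner of the item if the word is divisible by the
content of register `14`. -/
def markItems (own : Expr) : Prog :=
  .count 12 20 (.seq (.random 13) (.cond (.bin .eq (.bin .mod (.reg 13) (.reg 14)) (.const 0))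
    (.store (.adr 6 own) (.const 1)) .skip))

/-- Propagate the marks along the edges in topological order. -/
def propagate : Prog :=
  .count 12 4 (.cond (.ld 6 tailExpr) (.store (.adr 6 headExpr) (.const 1)) .skip)

/-- Increment the counters of the marked vertices and remove the marks. -/
def tally : Prog :=
  .count 12 3 (.seq
    (.cond (.ld 6 (.reg 12))
      (.store (.adr 7 (.reg 12)) (.bin .add (.ld 7 (.reg 12)) (.const 1))) .skip)
    (.store (.adr 6 (.reg 12)) (.const 0)))

/-- Replace the estimates of the vertices whose counters have reached the threshold and reset the
counters. -/
def conclude (out : ℕ) : Prog :=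
  .count 12 3 (.seq
    (.cond (.bin .lt (.ld 7 (.reg 12)) (.reg 8)) .skip
      (.store (.adr out (.reg 12))
        (.bin .div
          (.bin .add (.bin .mul (.const 2) (.bin .mul (.ld 7 (.reg 12)) (.reg 14))) (.reg 6))
          (.bin .mul (.const 2) (.reg 6)))))
    (.store (.adr 7 (.reg 12)) (.const 0)))

/-- The estimation phase for items with owner `own` and result array `out`. -/
def estimate (own : Expr) (out : ℕ) : Prog :=
  .count 10 7 (.seq (.assign 14 (.bin .shl (.const 1) (.reg 10)))
    (.seq (.count 11 6 (.seq (markItems own) (.seq propagate tally))) (conclude out)))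

/-- The estimation phase may change only the registers `10, …, 14` and the arrays `6`, `7`, `out`. -/
structure Same (S out : ℕ) (s t : State) : Prop where
  regs : ∀ r, r < 10 ∨ 14 < r → t.regs r = s.regs r
  arr : ∀ k < 16, k ≠ 6 → k ≠ 7 → k ≠ out → ∀ x < S, t.arr S k x = s.arr S k x

/-- The data with which the estimation phase works. -/
structure EstSetup (w S N m R I thr J out : ℕ) (T H σ own : ℕ → ℕ) (ownE : Expr) (s : State) :
    Prop where
  hS : 16 * S ≤ 2 ^ w
  hN : N < S
  hm : 2 * m + 4 < S
  hJ : J < 2 ^ w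
  hI : I ≤ w
  hR : 2 * (R * 2 ^ I) + 2 * R < 2 ^ w
  hout : out = 8 ∨ out = 9
  reg2 : s.regs 2 = S
  reg3 : s.regs 3 = N
  reg4 : s.regs 4 = m
  reg6 : s.regs 6 = R
  reg7 : s.regs 7 = I
  reg8 : s.regs 8 = thr
  reg20 : s.regs 20 = J
  tail : ∀ k < m, s.arr S 0 (3 + 2 * k) = T k
  head : ∀ k < m, s.arr S 0 (4 + 2 * k) = H k
  order : ∀ k < m, s.arr S 5 k = σ k
  hT : ∀ k < m, T k < N
  hH : ∀ k < m, H k < N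
  top : IsTopOrder T H m σ
  own_lt : ∀ j < J, own j < N
  own_value : ∀ t, Same S out s t → t.regs 12 < J → ownE.value w t = own (t.regs 12)
  cost : ownE.cost ≤ 12

/-- The state during the estimation phase: the level, the repetition, the marks, the counters, the
estimates and the number of random words drawn so far. -/
structure Mid (S N out : ℕ) (s : State) (i r P : ℕ) (mk : ℕ → Prop) (cnt est : ℕ → ℕ) (dr : ℕ)
    (t : State) : Prop where
  same : Same S out s t
  reg10 : t.regs 10 = i
  reg11 : t.regs 11 = r
  reg14 : t.regs 14 = P
  mark : ∀ v < N, t.arr S 6 v ≠ 0 ↔ mk v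
  count : ∀ v < N, t.arr S 7 v = cnt v
  est : ∀ v < N, t.arr S out v = est v
  drawn : t.drawn = dr

variable {w : ℕ} {ω : ℕ → Fin (2 ^ w)} {S N m R I thr J out : ℕ} {T H σ own : ℕ → ℕ} {ownE : Expr}
  {s t : State} {i r P dr : ℕ} {mk mk' : ℕ → Prop} {cnt cnt' est est' : ℕ → ℕ}

/-! ### Frame conditions: the effect of single writes on the estimation state. -/

theorem Same.refl (S out : ℕ) (s : State) : Same S out s s :=
  ⟨fun _ _ => rfl, fun _ _ _ _ _ _ _ => rfl⟩

theorem Same.setReg (h : Same S out s t) {r x : ℕ} (h1 : 10 ≤ r) (h2 : r ≤ 14) :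
    Same S out s (t.setReg r x) :=
  ⟨fun q hq => by simp [show q ≠ r by omega, h.regs q hq], h.arr⟩

theorem Same.draw (h : Same S out s t) {r x : ℕ} (h1 : 10 ≤ r) (h2 : r ≤ 14) :
    Same S out s (t.draw r x) :=
  ⟨fun q hq => by simp [show q ≠ r by omega, h.regs q hq], h.arr⟩

theorem Same.setMem (h : Same S out s t) {k x y : ℕ} (hk : k = 6 ∨ k = 7 ∨ k = out) (hx : x < S) :
    Same S out s (t.setMem (k * S + x) y) :=
  ⟨h.regs, fun q hq h6 h7 ho z hz => by
    rw [State.setMem_arr _ hx hz, if_neg (by omega), h.arr q hq h6 h7 ho z hz]⟩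

theorem Mid.congr (h : Mid S N out s i r P mk cnt est dr t) (h1 : ∀ v < N, mk v ↔ mk' v)
    (h2 : ∀ v < N, cnt v = cnt' v) (h3 : ∀ v < N, est v = est' v) :
    Mid S N out s i r P mk' cnt' est' dr t :=
  { h with
    mark := fun v hv => (h.mark v hv).trans (h1 v hv)
    count := fun v hv => (h.count v hv).trans (h2 v hv)
    est := fun v hv => (h.est v hv).trans (h3 v hv) }

theorem Mid.setReg12 (h : Mid S N out s i r P mk cnt est dr t) (x : ℕ) :
    Mid S N out s i r P mk cnt est dr (t.setReg 12 x) :=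
  ⟨h.same.setReg (by norm_num) (by norm_num), by simp [h.reg10], by simp [h.reg11],
    by simp [h.reg14], h.mark, h.count, h.est, h.drawn⟩

theorem Mid.draw (h : Mid S N out s i r P mk cnt est dr t) (x : ℕ) :
    Mid S N out s i r P mk cnt est (dr + 1) (t.draw 13 x) :=
  ⟨h.same.draw (by norm_num) (by norm_num), by simp [h.reg10], by simp [h.reg11],
    by simp [h.reg14], h.mark, h.count, h.est, by simp [h.drawn]⟩

theorem Mid.setMark (h : Mid S N out s i r P mk cnt est dr t) {x y : ℕ} (hN : N < S) (hx : x < N)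
    (ho : out = 8 ∨ out = 9) (h1 : ∀ v < N, mk' v ↔ if v = x then y ≠ 0 else mk v) :
    Mid S N out s i r P mk' cnt est dr (t.setMem (6 * S + x) y) :=
  ⟨h.same.setMem (by simp) (by omega), h.reg10, h.reg11, h.reg14, fun v hv => by
    rw [State.setMem_arr _ (by omega) (by omega), h1 v hv]
    by_cases hvx : v = x
    · simp [hvx]
    · simp [hvx, h.mark v hv],
    fun v hv => by
      rw [State.setMem_arr _ (by omega) (by omega), if_neg (by omega), h.count v hv],
    fun v hv => by
      rw [State.setMem_arr _ (by omega) (by omega), if_neg (by omega), h.est v hv], h.drawn⟩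

theorem Mid.setCount (h : Mid S N out s i r P mk cnt est dr t) {x y : ℕ} (hN : N < S) (hx : x < N)
    (ho : out = 8 ∨ out = 9) (h1 : ∀ v < N, cnt' v = if v = x then y else cnt v) :
    Mid S N out s i r P mk cnt' est dr (t.setMem (7 * S + x) y) :=
  ⟨h.same.setMem (by simp) (by omega), h.reg10, h.reg11, h.reg14, fun v hv => by
      rw [State.setMem_arr _ (by omega) (by omega), if_neg (by omega), h.mark v hv],
    fun v hv => by
      rw [State.setMem_arr _ (by omega) (by omega), h1 v hv, h.count v hv]
      simp,
    fun v hv => by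
      rw [State.setMem_arr _ (by omega) (by omega), if_neg (by omega), h.est v hv], h.drawn⟩

theorem Mid.setEst (h : Mid S N out s i r P mk cnt est dr t) {x y : ℕ} (hN : N < S) (hx : x < N)
    (ho : out = 8 ∨ out = 9) (h1 : ∀ v < N, est' v = if v = x then y else est v) :
    Mid S N out s i r P mk cnt est' dr (t.setMem (out * S + x) y) :=
  ⟨h.same.setMem (by simp) (by omega), h.reg10, h.reg11, h.reg14, fun v hv => by
      rw [State.setMem_arr _ (by omega) (by omega), if_neg (by omega), h.mark v hv],
    fun v hv => by
      rw [State.setMem_arr _ (by omega) (by omega), if_neg (by omega), h.count v hv],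
    fun v hv => by
      rw [State.setMem_arr _ (by omega) (by omega), h1 v hv, h.est v hv]
      simp, h.drawn⟩

/-! ### Correctness of the pieces of the estimation phase. -/

section

variable (hs : EstSetup w S N m R I thr J out T H σ own ownE s)
include hs

theorem EstSetup.reg2' (h : Same S out s t) : t.regs 2 = S := by rw [h.regs 2 (by norm_num), hs.reg2]

theorem EstSetup.out_lt : out < 16 := by rcases hs.hout with h | h <;> omega

theorem EstSetup.value_endpoint (h : Same S out s t) {k c : ℕ} (h12 : t.regs 12 = k) (hk : k < m)
    (hc : c ≤ 4) :
    (Expr.ld 0 (.bin .add (.const c) (.bin .mul (.const 2) (.ld 5 (.reg 12))))).value w t =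
      t.arr S 0 (c + 2 * σ k) := by
  have h1 := hs.hS
  have h2 := hs.hm
  have h3 := hs.top.lt k hk
  have ho : out ≠ 5 := by rcases hs.hout with h | h <;> omega
  have h4 : (Expr.ld 5 (.reg 12)).value w t = σ k := by
    rw [value_ld h1 (hs.reg2' h) (by norm_num) (show (Expr.reg 12).value w t = k from h12) (by omega),
      h.arr 5 (by norm_num) (by norm_num) (by norm_num) ho.symm k (by omega), hs.order k hk]
  exact value_ld h1 (hs.reg2' h) (by norm_num)
    (value_add (value_const (by omega)) (value_mul (value_const (by omega)) h4 (by omega))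
      (by omega)) (by omega)

theorem EstSetup.value_tail (h : Same S out s t) {k : ℕ} (h12 : t.regs 12 = k) (hk : k < m) :
    tailExpr.value w t = T (σ k) := by
  have h2 := hs.hm
  have h3 := hs.top.lt k hk
  have ho : out ≠ 0 := by rcases hs.hout with h | h <;> omega
  rw [tailExpr, hs.value_endpoint h h12 hk (by norm_num),
    h.arr 0 (by norm_num) (by norm_num) (by norm_num) ho.symm _ (by omega), hs.tail _ h3]

theorem EstSetup.value_head (h : Same S out s t) {k : ℕ} (h12 : t.regs 12 = k) (hk : k < m) :
    headExpr.value w t = H (σ k) := by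
  have h2 := hs.hm
  have h3 := hs.top.lt k hk
  have ho : out ≠ 0 := by rcases hs.hout with h | h <;> omega
  rw [headExpr, hs.value_endpoint h h12 hk (by norm_num),
    h.arr 0 (by norm_num) (by norm_num) (by norm_num) ho.symm _ (by omega), hs.head _ h3]

/-- Every item consumes exactly one word, whether it is marked or not, so item `j` is governed by
word `dr + j` in every run. -/
theorem EstSetup.run_markItems (h : Mid S N out s i r P (fun _ => False) cnt est dr t) :
    Run w ω (markItems ownE) t (48 * J + 6) (Mid S N out s i r P
      (fun u => ∃ j < J, own j = u ∧ (ω (dr + j) : ℕ) % P = 0) cnt est (dr + J)) := by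
  have h1 := hs.hS
  have h2 := hs.hN
  have h3 := hs.cost
  refine Run.count (n := J) (B := 40) (fun k => Mid S N out s i r P
    (fun u => ∃ j < k, own j = u ∧ (ω (dr + j) : ℕ) % P = 0) cnt est (dr + k))
    (by norm_num) hs.hJ (by rw [h.same.regs 20 (by norm_num), hs.reg20]) ?_ ?_ (fun _ => id)
    (by omega)
  · exact (h.setReg12 0).congr (by simp) (by simp) (by simp)
  · intro k hk t ht h12
    refine Run.seq (B₁ := 1) (B₂ := 38) ?_ (by norm_num)
    refine Run.random ?_ le_rfl
    have hd := ht.draw (ω t.drawn : ℕ)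
    have key : (Expr.bin .eq (.bin .mod (.reg 13) (.reg 14)) (.const 0)).value w
        (t.draw 13 (ω t.drawn)) = if (ω (dr + k) : ℕ) % P = 0 then 1 else 0 := by
      simp [Expr.value, BinOp.apply, ht.reg14, ht.drawn]
    refine Run.cond (B := 32) (fun hb => ?_) (fun hb => ?_) (by simp [Expr.cost])
    · have hm : (ω (dr + k) : ℕ) % P = 0 := by
        by_contra hc
        rw [key, if_neg hc] at hb
        exact hb rfl
      have ho : ownE.value w (t.draw 13 (ω t.drawn)) = own k := by
        rw [hs.own_value _ hd.same (by simp [h12, hk])]; simp [h12]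
      refine Run.store (value_adr h1 (hs.reg2' hd.same) (by norm_num) ho
        ((hs.own_lt k hk).trans h2)) (value_const (by omega)) ⟨by simp [h12], by simp, ?_⟩
        (by simp only [Expr.cost, Expr.adr]; omega)
      refine Mid.setReg12 (Mid.setMark hd h2 (hs.own_lt k hk) hs.hout fun v hv => ?_) _
      by_cases hvk : v = own k
      · simp only [hvk, if_true, ne_eq, one_ne_zero, not_false_eq_true, iff_true]
        exact ⟨k, by omega, rfl, hm⟩
      · simp only [hvk, if_false]
        constructor
        · rintro ⟨j, hj, h5, h6⟩
          rcases Nat.lt_succ_iff_lt_or_eq.1 hj with h7 | rfl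
          · exact ⟨j, h7, h5, h6⟩
          · exact absurd h5.symm hvk
        · rintro ⟨j, hj, h5⟩
          exact ⟨j, by omega, h5⟩
    · have hm : ¬ (ω (dr + k) : ℕ) % P = 0 := by
        intro hc
        rw [key, if_pos hc] at hb
        exact one_ne_zero hb
      refine Run.skip ⟨by simp [h12], by simp, ?_⟩ (by norm_num)
      refine Mid.setReg12 (hd.congr (fun v hv => ?_) (by simp) (by simp)) _
      constructor
      · rintro ⟨j, hj, h5⟩
        exact ⟨j, by omega, h5⟩
      · rintro ⟨j, hj, h5, h6⟩
        rcases Nat.lt_succ_iff_lt_or_eq.1 hj with h7 | rfl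
        · exact ⟨j, h7, h5, h6⟩
        · exact absurd h6 hm

/-- One scan suffices because of the topological order: the invariant `HitUpTo` advances by
`hitUpTo_succ` and ends as reachability from a marked vertex. -/
theorem EstSetup.run_propagate (h : Mid S N out s i r P mk cnt est dr t) :
    Run w ω propagate t (68 * m + 6) (Mid S N out s i r P (HitFrom T H m mk) cnt est dr) := by
  have h1 := hs.hS
  have h2 := hs.hN
  have h3 := hs.hm
  refine Run.count (n := m) (B := 60) (fun k => Mid S N out s i r P (HitUpTo T H m σ mk k) cnt est
    dr) (by norm_num) (by omega) (by rw [h.same.regs 4 (by norm_num), hs.reg4]) ?_ ?_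
    (fun t ht => ht.congr (fun v _ => hs.top.hitUpTo_last) (by simp) (by simp)) (by omega)
  · exact (h.setReg12 0).congr (fun v _ => hitUpTo_zero.symm) (by simp) (by simp)
  · intro k hk t ht h12
    have hσ := hs.top.lt k hk
    have hT := hs.hT _ hσ
    have hH := hs.hH _ hσ
    have key := value_ld h1 (hs.reg2' ht.same) (k := 6) (by norm_num)
      (hs.value_tail ht.same h12 hk) (by omega)
    refine Run.cond (B := 30) (fun hb => ?_) (fun hb => ?_)
      (by simp [Expr.cost, tailExpr, Expr.ld, Expr.adr])
    · rw [key, ht.mark _ hT] at hb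
      refine Run.store (value_adr h1 (hs.reg2' ht.same) (by norm_num)
        (hs.value_head ht.same h12 hk) (by omega)) (value_const (by omega)) ⟨h12, rfl, ?_⟩
        (by simp [Expr.cost, headExpr, Expr.ld, Expr.adr])
      refine Mid.setReg12 (ht.setMark h2 hH hs.hout fun v hv => ?_) _
      rw [hs.top.hitUpTo_succ hk]
      by_cases hv' : v = H (σ k) <;> simp [hv', hb]
    · rw [key] at hb
      have hb' : ¬ HitUpTo T H m σ mk k (T (σ k)) := by rw [← ht.mark _ hT]; simpa using hb
      refine Run.skip ⟨h12, rfl, ?_⟩ (by norm_num)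
      refine Mid.setReg12 (ht.congr (fun v hv => ?_) (by simp) (by simp)) _
      rw [hs.top.hitUpTo_succ hk]
      simp [hb']

open Classical in
theorem EstSetup.run_tally (h : Mid S N out s i r P mk cnt est dr t)
    (hc : ∀ v < N, cnt v + 1 < 2 ^ w) :
    Run w ω tally t (58 * N + 6) (Mid S N out s i r P (fun _ => False)
      (fun v => cnt v + if mk v then 1 else 0) est dr) := by
  have h1 := hs.hS
  have h2 := hs.hN
  refine Run.count (n := N) (B := 50) (fun k => Mid S N out s i r P (fun v => k ≤ v ∧ mk v)
    (fun v => cnt v + if v < k ∧ mk v then 1 else 0) est dr)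
    (by norm_num) (by omega) (by rw [h.same.regs 3 (by norm_num), hs.reg3]) ?_ ?_
    (fun t ht => ht.congr (fun v hv => ?_) (fun v hv => ?_) (by simp)) (by omega)
  · exact (h.setReg12 0).congr (by simp) (by simp) (by simp)
  · intro k hk t ht h12
    have h12' : (Expr.reg 12).value w t = k := h12
    have key := value_ld h1 (hs.reg2' ht.same) (k := 6) (by norm_num) h12' (by omega)
    have key7 := value_ld h1 (hs.reg2' ht.same) (k := 7) (by norm_num) h12' (by omega)
    have ha := value_adr h1 (hs.reg2' ht.same) (k := 7) (by norm_num) h12' (by omega)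
    rw [ht.count k hk] at key7
    simp only [lt_self_iff_false, false_and, if_false, add_zero] at key7
    refine Run.seq (B₁ := 30) (B₂ := 10)
      (Q := fun u => u.regs 12 = k ∧ u.regs 3 = t.regs 3 ∧ Mid S N out s i r P
        (fun v => k + 1 ≤ v ∧ mk v) (fun v => cnt v + if v < k + 1 ∧ mk v then 1 else 0) est dr
        (u.setReg 12 (k + 1))) (?_ : Run w ω _ t 30 _) (by norm_num)
    -- The configuration halfway through a pass: the counter of vertex `k` is updated, its mark is
    -- not yet erased.
    refine Run.mono (B := 30) (Q := fun u => u.regs 12 = k ∧ u.regs 3 = t.regs 3 ∧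
      Mid S N out s i r P (fun v => k ≤ v ∧ mk v)
        (fun v => cnt v + if v < k + 1 ∧ mk v then 1 else 0) est dr u) ?_ le_rfl ?_
    · refine Run.cond (B := 22) (fun hb => ?_) (fun hb => ?_)
        (by simp [Expr.cost, Expr.ld, Expr.adr])
      · rw [key, ht.mark _ hk] at hb
        refine Run.store ha (value_add key7 (value_const (by omega)) (hc k hk)) ⟨h12, rfl, ?_⟩
          (by simp [Expr.cost, Expr.ld, Expr.adr])
        refine ht.setCount h2 hk hs.hout fun v hv => ?_
        by_cases hvk : v = k
        · simp [hvk, hb.2]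
        · have : v < k + 1 ↔ v < k := by omega
          simp [hvk, this]
      · rw [key] at hb
        have hb' : ¬ mk k := fun hm => (ht.mark k hk).2 ⟨le_rfl, hm⟩ hb
        refine Run.skip ⟨h12, rfl, ht.congr (by simp) (fun v hv => ?_) (by simp)⟩ (by norm_num)
        by_cases hvk : v = k
        · simp [hvk, hb']
        · have : v < k + 1 ↔ v < k := by omega
          simp [this]
    · rintro u ⟨hu1, hu2, hu3⟩
      refine Run.store (value_adr h1 (hs.reg2' hu3.same) (x := k) (by norm_num) hu1 (by omega))
        (value_const (by omega)) ⟨hu1, hu2, ?_⟩ (by simp [Expr.cost, Expr.adr])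
      refine Mid.setReg12 (hu3.setMark h2 hk hs.hout fun v hv => ?_) _
      by_cases hvk : v = k
      · simp [hvk]
      · have : k + 1 ≤ v ↔ k ≤ v := by omega
        simp [hvk, this]
  · simp only [iff_false]; omega
  · simp [hv]

/-- Counters never exceed `R`, so the word length bound `hR` keeps numerator and denominator of
`scaledCount` below `2 ^ w`, and the machine division is exact. -/
theorem EstSetup.run_conclude (h : Mid S N out s i r P (fun _ => False) cnt est dr t) (hi : i ≤ I)
    (hP : P = 2 ^ i) (hc : ∀ v < N, cnt v ≤ R) :
    Run w ω (conclude out) t (58 * N + 6) (Mid S N out s i r P (fun _ => False) (fun _ => 0)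
      (fun v => if cnt v < thr then est v else scaledCount R i (cnt v)) dr) := by
  have h1 := hs.hS
  have h2 := hs.hN
  have h3 := hs.hR
  refine Run.count (n := N) (B := 50) (fun k => Mid S N out s i r P (fun _ => False)
    (fun v => if v < k then 0 else cnt v)
    (fun v => if v < k ∧ ¬ cnt v < thr then scaledCount R i (cnt v) else est v) dr)
    (by norm_num) (by omega) (by rw [h.same.regs 3 (by norm_num), hs.reg3]) ?_ ?_
    (fun t ht => ht.congr (by simp) (fun v hv => ?_) (fun v hv => ?_)) (by omega)
  · exact (h.setReg12 0).congr (by simp) (by simp) (by simp)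
  · intro k hk t ht h12
    have h12' : (Expr.reg 12).value w t = k := h12
    have key7 := value_ld h1 (hs.reg2' ht.same) (k := 7) (by norm_num) h12' (by omega)
    have ha := value_adr h1 (hs.reg2' ht.same) (k := out) hs.out_lt h12' (by omega)
    rw [ht.count k hk] at key7
    simp only [lt_self_iff_false, if_false] at key7
    refine Run.seq (B₁ := 40) (B₂ := 10)
      (Q := fun u => u.regs 12 = k ∧ u.regs 3 = t.regs 3 ∧ Mid S N out s i r P
        (fun _ => False) (fun v => if v < k + 1 then 0 else cnt v)
        (fun v => if v < k + 1 ∧ ¬ cnt v < thr then scaledCount R i (cnt v) else est v) dr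
        (u.setReg 12 (k + 1))) (?_ : Run w ω _ t 40 _) (by norm_num)
    refine Run.mono (B := 40) (Q := fun u => u.regs 12 = k ∧ u.regs 3 = t.regs 3 ∧
      Mid S N out s i r P (fun _ => False) (fun v => if v < k then 0 else cnt v)
        (fun v => if v < k + 1 ∧ ¬ cnt v < thr then scaledCount R i (cnt v) else est v) dr u)
      ?_ le_rfl ?_
    · have hr8 : (Expr.reg 8).value w t = thr := by
        show t.regs 8 = thr
        rw [ht.same.regs 8 (by norm_num), hs.reg8]
      have hr6 : (Expr.reg 6).value w t = R := by
        show t.regs 6 = R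
        rw [ht.same.regs 6 (by norm_num), hs.reg6]
      have hr14 : (Expr.reg 14).value w t = 2 ^ i := ht.reg14.trans hP
      have hlt : (Expr.bin .lt (.ld 7 (.reg 12)) (.reg 8)).value w t =
          if cnt k < thr then 1 else 0 := by
        simp only [Expr.value] at key7 hr8 ⊢
        rw [key7, hr8, BinOp.apply]
      refine Run.cond (B := 28) (fun hb => ?_) (fun hb => ?_)
        (by simp [Expr.cost, Expr.ld, Expr.adr])
      · have hb' : cnt k < thr := by
          by_contra hcon
          rw [hlt, if_neg hcon] at hb
          exact hb rfl
        refine Run.skip ⟨h12, rfl, ht.congr (by simp) (by simp) (fun v hv => ?_)⟩ (by norm_num)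
        by_cases hvk : v = k
        · simp [hvk, hb']
        · have : v < k + 1 ↔ v < k := by omega
          simp [this]
      · have hb' : ¬ cnt k < thr := by
          intro hcon
          rw [hlt, if_pos hcon] at hb
          exact one_ne_zero hb
        have hci : cnt k * 2 ^ i ≤ R * 2 ^ I :=
          Nat.mul_le_mul (hc k hk) (Nat.pow_le_pow_right (by norm_num) hi)
        have hnum := value_add (value_mul (value_const (w := w) (s := t) (k := 2) (by omega))
          (value_mul key7 hr14 (by omega)) (by omega)) hr6 (by omega)
        have hden := value_mul (value_const (w := w) (s := t) (k := 2) (by omega)) hr6 (by omega)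
        refine Run.store (x := scaledCount R i (cnt k)) ha ?_ ⟨h12, rfl, ?_⟩
          (by simp [Expr.cost, Expr.ld, Expr.adr])
        · rw [Expr.value, hnum, hden]; rfl
        · refine ht.setEst h2 hk hs.hout fun v hv => ?_
          by_cases hvk : v = k
          · simp only [hvk, if_true]
            rw [if_pos ⟨by omega, hb'⟩]
          · have : v < k + 1 ↔ v < k := by omega
            simp [hvk, this]
    · rintro u ⟨hu1, hu2, hu3⟩
      refine Run.store (value_adr h1 (hs.reg2' hu3.same) (x := k) (by norm_num) hu1 (by omega))
        (value_const (by omega)) ⟨hu1, hu2, ?_⟩ (by simp [Expr.cost, Expr.adr])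
      refine Mid.setReg12 (hu3.setCount h2 hk hs.hout fun v hv => ?_) _
      by_cases hvk : v = k
      · simp [hvk]
      · have : v < k + 1 ↔ v < k := by omega
        simp [hvk, this]
  · simp [hv]
  · by_cases hcv : cnt v < thr <;> simp [hv, hcv]

end

open Classical in
/-- The number of repetitions among the first `n` of level `i` in which a marked item reaches `v`,
when the estimation phase starts with the random word number `dr`. -/
noncomputable def hitCount (ω : ℕ → Fin (2 ^ w)) (T H : ℕ → ℕ) (m : ℕ) (own : ℕ → ℕ) (J R dr : ℕ)
    (i n v : ℕ) : ℕ :=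
  Nat.count (fun r => HitFrom T H m
    (fun u => ∃ j < J, own j = u ∧ (ω (dr + (i * R + r) * J + j) : ℕ) % 2 ^ i = 0) v) n

theorem hitCount_le {i n v : ℕ} : hitCount ω T H m own J R dr i n v ≤ n := by
  classical exact Nat.count_le _

/-- The estimation phase computes the estimates `levelEstimate` from the numbers of hits. -/
theorem EstSetup.run_estimate (hs : EstSetup w S N m R I thr J out T H σ own ownE s)
    (h6 : ∀ v < N, s.arr S 6 v = 0) (h7 : ∀ v < N, s.arr S 7 v = 0)
    (ho : ∀ v < N, s.arr S out v = 0) :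
    Run w ω (estimate ownE out) s
      (I * (R * (48 * J + 68 * m + 58 * N + 26) + 58 * N + 30) + 6) fun t =>
        Same S out s t ∧ (∀ v < N, t.arr S 6 v = 0) ∧ (∀ v < N, t.arr S 7 v = 0) ∧
        (∀ v < N, t.arr S out v = levelEstimate R thr
          (fun i => hitCount ω T H m own J R s.drawn i R v) I) ∧
        t.drawn = s.drawn + I * R * J := by
  classical
  have h1 := hs.hS
  have h2 := hs.hN
  have h3 := hs.hR
  have hI := hs.hI
  have hRlt : R < 2 ^ w := by omega
  have hIlt : I < 2 ^ w := lt_of_le_of_lt hI Nat.lt_two_pow_self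
  refine Run.count (n := I) (B := R * (48 * J + 68 * m + 58 * N + 26) + 58 * N + 22)
    -- Between levels the registers `11` and `14` hold leftovers, so the invariant takes their
    -- contents as they are.
    (fun i t => t.regs 10 = i ∧ Mid S N out s i (t.regs 11) (t.regs 14) (fun _ => False) (fun _ => 0)
      (fun v => levelEstimate R thr (fun i => hitCount ω T H m own J R s.drawn i R v) i)
      (s.drawn + i * R * J) t) (by norm_num) hIlt hs.reg7 ?_ ?_ ?_
      (by rw [show R * (48 * J + 68 * m + 58 * N + 26) + 58 * N + 22 + 8 =
        R * (48 * J + 68 * m + 58 * N + 26) + 58 * N + 30 by ring])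
  · refine ⟨by simp, ⟨(Same.refl S out s).setReg (by norm_num) (by norm_num), by simp, rfl, rfl,
      fun v hv => by simp [h6 v hv], fun v hv => by simp [h7 v hv],
      fun v hv => by simp [ho v hv, levelEstimate], by simp⟩⟩
  · rintro i hi t ⟨h10, ht⟩ -
    refine Run.seq (B₁ := 4) (B₂ := R * (48 * J + 68 * m + 58 * N + 26) + 58 * N + 18) ?_ (by omega)
    refine Run.assign (x := 2 ^ i) (value_shl_one (a := i) h10 (by omega) (by omega)) ?_
      (by simp [Expr.cost])
    refine Run.seq (B₁ := R * (48 * J + 68 * m + 58 * N + 26) + 6) (B₂ := 58 * N + 6) ?_ (by omega)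
    refine Run.count (n := R) (B := 48 * J + 68 * m + 58 * N + 18)
      (fun r t => Mid S N out s i r (2 ^ i) (fun _ => False)
        (fun v => hitCount ω T H m own J R s.drawn i r v)
        (fun v => levelEstimate R thr (fun i => hitCount ω T H m own J R s.drawn i R v) i)
        (s.drawn + (i * R + r) * J) t) (by norm_num) hRlt
        (by simp [ht.same.regs 6 (by norm_num), hs.reg6]) ?_ ?_ ?_
        (by rw [show 48 * J + 68 * m + 58 * N + 18 + 8 = 48 * J + 68 * m + 58 * N + 26 by ring])
    · refine ⟨(ht.same.setReg (by norm_num) (by norm_num)).setReg (by norm_num) (by norm_num),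
        by simp [h10], by simp, by simp, ht.mark, fun v hv => ?_, ht.est, by simp [ht.drawn]⟩
      simpa [hitCount] using ht.count v hv
    · intro r hr t ht _
      refine Run.seq (B₁ := 48 * J + 6) (B₂ := 68 * m + 58 * N + 12) ?_ (by omega)
      refine (hs.run_markItems ht).mono le_rfl fun t2 ht2 => ?_
      refine Run.seq (B₁ := 68 * m + 6) (B₂ := 58 * N + 6) ?_ (by omega)
      refine (hs.run_propagate ht2).mono le_rfl fun t3 ht3 => ?_
      refine (hs.run_tally ht3 fun v hv => ?_).mono le_rfl fun t4 ht4 => ?_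
      · have : hitCount ω T H m own J R s.drawn i r v ≤ r := hitCount_le
        omega
      · refine ⟨ht4.reg11, ?_, ⟨ht4.same.setReg (by norm_num) (by norm_num), by simp [ht4.reg10],
          by simp, by simp [ht4.reg14], ht4.mark, fun v hv => ?_, ht4.est, ?_⟩⟩
        · rw [ht4.same.regs 6 (by norm_num), ht.same.regs 6 (by norm_num)]
        · rw [State.setReg_arr, ht4.count v hv]
          simp only [hitCount, Nat.count_succ]
        · rw [State.setReg_drawn, ht4.drawn]; ring
    · intro t1 ht1
      refine (hs.run_conclude ht1 hi.le rfl fun v hv => hitCount_le).mono le_rfl fun t2 ht2 => ?_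
      refine ⟨ht2.reg10, ?_, by simp, ?_⟩
      · rw [ht2.same.regs 7 (by norm_num), ht.same.regs 7 (by norm_num)]
      · refine ⟨ht2.same.setReg (by norm_num) (by norm_num), by simp, by simp, by simp, ht2.mark,
          ht2.count, ?_, ?_⟩
        -- Levels are visited in increasing order and later ones overwrite earlier results, which is
        -- the recursion defining `levelEstimate`.
        · intro v hv
          rw [State.setReg_arr, ht2.est v hv]
          rfl
        · rw [State.setReg_drawn, ht2.drawn]; ring
  · rintro t ⟨-, ht⟩
    exact ⟨ht.same, fun v hv => by simpa using ht.mark v hv, ht.count, ht.est, ht.drawn⟩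


/-! ### The sorting phase -/

/-- Build linked lists of the outgoing edges of each vertex (arrays `1` and `2`) and the array `3`
of the in-degrees. -/
def buildLists : Prog :=
  .count 12 4
    (.seq (.assign 19 (.ld 0 (.bin .add (.const 3) (.bin .mul (.const 2) (.reg 12)))))
    (.seq (.store (.adr 2 (.reg 12)) (.ld 1 (.reg 19)))
    (.seq (.store (.adr 1 (.reg 19)) (.bin .add (.reg 12) (.const 1)))
    (.seq (.assign 19 (.ld 0 (.bin .add (.const 4) (.bin .mul (.const 2) (.reg 12)))))
      (.store (.adr 3 (.reg 19)) (.bin .add (.ld 3 (.reg 19)) (.const 1)))))))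

/-- Put the vertices without incoming edges into the queue (array `4`). -/
def initQueue : Prog :=
  .count 12 3 (.cond (.ld 3 (.reg 12)) .skip
    (.seq (.store (.adr 4 (.reg 16)) (.reg 12))
      (.assign 16 (.bin .add (.reg 16) (.const 1)))))

/-- List the edge in register `17` in array `5`. -/
def emitEdge : Prog :=
  .seq (.store (.adr 5 (.reg 18)) (.bin .sub (.reg 17) (.const 1)))
  (.seq (.assign 18 (.bin .add (.reg 18) (.const 1)))
  (.seq (.assign 19 (.ld 0 (.bin .add (.const 2) (.bin .mul (.const 2) (.reg 17)))))
  (.seq (.assign 17 (.ld 2 (.bin .sub (.reg 17) (.const 1))))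
  (.seq (.store (.adr 3 (.reg 19)) (.bin .sub (.ld 3 (.reg 19)) (.const 1)))
    (.cond (.ld 3 (.reg 19)) .skip
      (.seq (.store (.adr 4 (.reg 16)) (.reg 19))
        (.assign 16 (.bin .add (.reg 16) (.const 1)))))))))

/-- Remove a vertex from the queue. -/
def popVertex : Prog :=
  .seq (.assign 17 (.ld 1 (.ld 4 (.reg 15)))) (.assign 15 (.bin .add (.reg 15) (.const 1)))

/-- Sort the edges topologically. -/
def sortEdges : Prog :=
  .seq buildLists (.seq initQueue
    (.loop (.bin .lor (.reg 17) (.bin .lt (.reg 15) (.reg 16)))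
      (.cond (.reg 17) emitEdge popVertex)))

/-- The sorting phase changes neither the registers below `10` nor array `0` nor the arrays from
`6` on. -/
structure Kept (S : ℕ) (s t : State) : Prop where
  regs : ∀ r, r < 10 → t.regs r = s.regs r
  arr : ∀ k < 16, k = 0 ∨ 6 ≤ k → ∀ x < S, t.arr S k x = s.arr S k x
  drawn : t.drawn = s.drawn

/-- The data with which the sorting phase works. -/
structure SortSetup (w S N m : ℕ) (T H : ℕ → ℕ) (s : State) : Prop where
  hS : 16 * S ≤ 2 ^ w
  hN : N < S
  hm : 2 * m + 4 < S
  reg2 : s.regs 2 = S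
  reg3 : s.regs 3 = N
  reg4 : s.regs 4 = m
  tail : ∀ k < m, s.arr S 0 (3 + 2 * k) = T k
  head : ∀ k < m, s.arr S 0 (4 + 2 * k) = H k
  hT : ∀ k < m, T k < N
  hH : ∀ k < m, H k < N

variable {w : ℕ} {ω : ℕ → Fin (2 ^ w)} {S N m : ℕ} {T H : ℕ → ℕ} {s t : State}

theorem Kept.refl (S : ℕ) (s : State) : Kept S s s := ⟨fun _ _ => rfl, fun _ _ _ _ _ => rfl, rfl⟩

theorem Kept.setReg (h : Kept S s t) {r x : ℕ} (h1 : 10 ≤ r) : Kept S s (t.setReg r x) :=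
  ⟨fun q hq => by simp [show q ≠ r by omega, h.regs q hq], h.arr, h.drawn⟩

theorem Kept.setMem (h : Kept S s t) {k x y : ℕ} (hk : 1 ≤ k) (hk' : k ≤ 5) (hx : x < S) :
    Kept S s (t.setMem (k * S + x) y) :=
  ⟨h.regs, fun q hq h6 z hz => by
    rw [State.setMem_arr _ hx hz, if_neg (by omega), h.arr q hq h6 z hz], h.drawn⟩

/-- The linked lists are complete for the first `k` edges. -/
structure Lists (S N m : ℕ) (T : ℕ → ℕ) (s : State) (k : ℕ) (t : State) : Prop where
  kept : Kept S s t
  first : ∀ u < N, t.arr S 1 u = lastOut T u k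
  next : ∀ j < k, t.arr S 2 j = lastOut T (T j) j

theorem Lists.setReg {k : ℕ} (h : Lists S N m T s k t) {r x : ℕ} (h1 : 10 ≤ r) :
    Lists S N m T s k (t.setReg r x) := ⟨h.kept.setReg h1, h.first, h.next⟩

theorem Lists.setMem {i k : ℕ} (h : Lists S N m T s i t) {x y : ℕ} (hN : N < S) (hi : i ≤ S)
    (hk : 3 ≤ k) (hk' : k ≤ 5) (hx : x < S) : Lists S N m T s i (t.setMem (k * S + x) y) :=
  ⟨h.kept.setMem (by omega) hk' hx,
    fun u hu => by
      rw [State.setMem_arr _ hx (by omega), if_neg (by omega), h.first u hu],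
    fun u hu => by
      rw [State.setMem_arr _ hx (by omega), if_neg (by omega), h.next u hu]⟩

theorem card_filter_range_succ (H : ℕ → ℕ) (k v : ℕ) :
    ((Finset.range (k + 1)).filter fun f => H f = v).card =
      ((Finset.range k).filter fun f => H f = v).card + if v = H k then 1 else 0 := by
  rw [Finset.range_add_one, Finset.filter_insert]
  by_cases h : H k = v
  · simp [h]
  · simp [h, Ne.symm h]

theorem card_filter_range_le (H : ℕ → ℕ) (k v : ℕ) :
    ((Finset.range k).filter fun f => H f = v).card ≤ k := by
  simpa using Finset.card_filter_le (Finset.range k) fun f => H f = v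

/-! ### Correctness and running time of the sorting programs. -/

section

variable (hs : SortSetup w S N m T H s)
include hs

theorem SortSetup.reg2' (h : Kept S s t) : t.regs 2 = S := by rw [h.regs 2 (by norm_num), hs.reg2]

theorem SortSetup.value_input (h : Kept S s t) {r k c : ℕ} (hr : t.regs r = k) (hk : c + 2 * k < S)
    (hc : c ≤ 4) :
    (Expr.ld 0 (.bin .add (.const c) (.bin .mul (.const 2) (.reg r)))).value w t =
      s.arr S 0 (c + 2 * k) := by
  have h1 := hs.hS
  have h2 := hs.hm
  rw [← h.arr 0 (by norm_num) (.inl rfl) _ hk]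
  exact value_ld h1 (hs.reg2' h) (by norm_num)
    (value_add (value_const (by omega)) (value_mul (value_const (by omega)) hr (by omega))
      (by omega)) (by omega)

theorem SortSetup.run_buildLists (h1 : ∀ u < N, s.arr S 1 u = 0) (h3 : ∀ u < N, s.arr S 3 u = 0)
    (h15 : s.regs 15 = 0) (h16 : s.regs 16 = 0) (h17 : s.regs 17 = 0) (h18 : s.regs 18 = 0) :
    Run w ω buildLists s (98 * m + 6) fun t => Lists S N m T s m t ∧
      (∀ v < N, t.arr S 3 v = ((Finset.range m).filter fun f => H f = v).card) ∧
      t.regs 15 = 0 ∧ t.regs 16 = 0 ∧ t.regs 17 = 0 ∧ t.regs 18 = 0 := by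
  have hS := hs.hS
  have hN := hs.hN
  have hm := hs.hm
  refine Run.count (n := m) (B := 90) (fun k t => Lists S N m T s k t ∧
      (∀ v < N, t.arr S 3 v = ((Finset.range k).filter fun f => H f = v).card) ∧
      t.regs 15 = 0 ∧ t.regs 16 = 0 ∧ t.regs 17 = 0 ∧ t.regs 18 = 0) (by norm_num) (by omega)
      hs.reg4 ?_ ?_ (fun _ => id) (by omega)
  · exact ⟨⟨(Kept.refl S s).setReg (by norm_num), by simpa [lastOut] using h1, by simp⟩,
      by simpa using h3, by simp [h15], by simp [h16], by simp [h17], by simp [h18]⟩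
  · rintro k hk t ⟨ht, ht3, r15, r16, r17, r18⟩ h12
    have hT := hs.hT k hk
    have hH := hs.hH k hk
    have hdeg := card_filter_range_le H k (H k)
    refine Run.seq (B₁ := 12) (B₂ := 78) ?_ (by norm_num)
    refine Run.assign (x := T k)
      ((hs.value_input ht.kept h12 (by omega) (by norm_num)).trans (hs.tail k hk)) ?_
      (by simp [Expr.cost, Expr.ld, Expr.adr])
    have a1 := ht.kept.setReg (r := 19) (x := T k) (by norm_num)
    refine Run.seq (B₁ := 20) (B₂ := 58) ?_ (by norm_num)
    -- The old list head is saved as the successor of edge `k` before edge `k` becomes the new head.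
    refine Run.store (x := lastOut T (T k) k)
      (value_adr hS (hs.reg2' a1) (x := k) (by norm_num) (by simp [Expr.value, h12]) (by omega))
      ((value_ld hS (hs.reg2' a1) (x := T k) (by norm_num) (by simp [Expr.value]) (by omega)).trans
        (by rw [State.setReg_arr, ht.first _ hT])) ?_ (by simp [Expr.cost, Expr.ld, Expr.adr])
    have a2 := a1.setMem (k := 2) (x := k) (y := lastOut T (T k) k) (by norm_num) (by norm_num)
      (by omega)
    refine Run.seq (B₁ := 20) (B₂ := 38) ?_ (by norm_num)
    refine Run.store (x := k + 1)
      (value_adr hS (hs.reg2' a2) (x := T k) (by norm_num) (by simp [Expr.value]) (by omega))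
      (value_add (by simp [Expr.value, h12]) (value_const (by omega)) (by omega)) ?_
      (by simp [Expr.cost, Expr.adr])
    have a3 := a2.setMem (k := 1) (x := T k) (y := k + 1) (by norm_num) (by norm_num) (by omega)
    refine Run.seq (B₁ := 12) (B₂ := 26) ?_ (by norm_num)
    refine Run.assign (x := H k)
      ((hs.value_input a3 (r := 12) (k := k) (by simp [h12]) (by omega) (by norm_num)).trans
        (hs.head k hk)) ?_ (by simp [Expr.cost, Expr.ld, Expr.adr])
    have a4 := a3.setReg (r := 19) (x := H k) (by norm_num)
    refine Run.store (x := ((Finset.range k).filter fun f => H f = H k).card + 1)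
      (value_adr hS (hs.reg2' a4) (x := H k) (by norm_num) (by simp [Expr.value]) (by omega))
      (value_add ((value_ld hS (hs.reg2' a4) (x := H k) (by norm_num) (by simp [Expr.value])
        (by omega)).trans ?_) (value_const (by omega)) (by omega)) ?_
      (by simp [Expr.cost, Expr.ld, Expr.adr])
    · rw [State.setReg_arr, State.setMem_arr _ (by omega) (by omega), if_neg (by omega),
        State.setMem_arr _ (by omega) (by omega), if_neg (by omega), State.setReg_arr, ht3 _ hH]
    have a5 := a4.setMem (k := 3) (x := H k)
      (y := ((Finset.range k).filter fun f => H f = H k).card + 1) (by norm_num) (by norm_num)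
      (by omega)
    refine ⟨by simp [h12], by simp, ⟨a5.setReg (by norm_num), fun u hu => ?_, fun j hj => ?_⟩,
      fun v hv => ?_, by simp [r15], by simp [r16], by simp [r17], by simp [r18]⟩
    · rw [State.setReg_arr, State.setMem_arr _ (by omega) (by omega), if_neg (by omega),
        State.setReg_arr, State.setMem_arr _ (by omega) (by omega)]
      simp only [true_and, lastOut, eq_comm (a := u)]
      split_ifs
      · rfl
      · rw [State.setMem_arr _ (by omega) (by omega), if_neg (by omega), State.setReg_arr,
          ht.first u hu]
    · rw [State.setReg_arr, State.setMem_arr _ (by omega) (by omega), if_neg (by omega),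
        State.setReg_arr, State.setMem_arr _ (by omega) (by omega), if_neg (by omega),
        State.setMem_arr _ (by omega) (by omega)]
      rcases Nat.lt_succ_iff_lt_or_eq.1 hj with h | rfl
      · rw [if_neg (by omega), State.setReg_arr, ht.next j h]
      · rw [if_pos ⟨rfl, rfl⟩]
    · rw [State.setReg_arr, State.setMem_arr _ (by omega) (by omega), card_filter_range_succ]
      by_cases hv' : v = H k
      · simp [hv']
      · rw [if_neg (by simp [hv']), State.setReg_arr, State.setMem_arr _ (by omega) (by omega),
          if_neg (by omega), State.setMem_arr _ (by omega) (by omega), if_neg (by omega),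
          State.setReg_arr, ht3 v hv, if_neg hv', add_zero]

theorem SortSetup.run_initQueue {deg : ℕ → ℕ} (ht : Lists S N m T s m t)
    (h3 : ∀ v < N, t.arr S 3 v = deg v)
    (h15 : t.regs 15 = 0) (h16 : t.regs 16 = 0) (h17 : t.regs 17 = 0) (h18 : t.regs 18 = 0) :
    Run w ω initQueue t (58 * N + 6) fun t => Lists S N m T s m t ∧
      (∀ v < N, t.arr S 3 v = deg v) ∧ t.regs 15 = 0 ∧ t.regs 17 = 0 ∧ t.regs 18 = 0 ∧
      (∀ p < t.regs 16, t.arr S 4 p < N) ∧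
      (∀ p < t.regs 16, ∀ q < t.regs 16, t.arr S 4 p = t.arr S 4 q → p = q) ∧
      (∀ v < N, deg v = 0 ↔ ∃ p < t.regs 16, t.arr S 4 p = v) := by
  have hS := hs.hS
  have hN := hs.hN
  have hm := hs.hm
  refine Run.count (n := N) (B := 50) (fun k t => Lists S N m T s m t ∧
      (∀ v < N, t.arr S 3 v = deg v) ∧ t.regs 15 = 0 ∧ t.regs 17 = 0 ∧ t.regs 18 = 0 ∧
      t.regs 16 ≤ k ∧ (∀ p < t.regs 16, t.arr S 4 p < k) ∧
      (∀ p < t.regs 16, ∀ q < t.regs 16, t.arr S 4 p = t.arr S 4 q → p = q) ∧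
      (∀ v < k, deg v = 0 ↔ ∃ p < t.regs 16, t.arr S 4 p = v)) (by norm_num) (by omega)
      (by rw [ht.kept.regs 3 (by norm_num), hs.reg3]) ?_ ?_
      (fun t ⟨h1, h2, h3, h4, h5, h6, h7, h8, h9⟩ => ⟨h1, h2, h3, h4, h5, h7, h8, h9⟩) (by omega)
  · exact ⟨ht.setReg (by norm_num), h3, by simp [h15], by simp [h17], by simp [h18],
      by simp [h16], by simp [h16], by simp [h16], by simp⟩
  · rintro k hk t ⟨ht, ht3, r15, r17, r18, r16, hlt, hinj, hiff⟩ h12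
    have key := value_ld hS (hs.reg2' ht.kept) (k := 3) (by norm_num)
      (show (Expr.reg 12).value w t = k from h12) (by omega)
    rw [ht3 k hk] at key
    have hfresh : ∀ p < t.regs 16, t.arr S 4 p ≠ k := fun p hp => (hlt p hp).ne
    refine Run.cond (B := 20) (fun hb => ?_) (fun hb => ?_)
      (by simp [Expr.cost, Expr.ld, Expr.adr])
    · rw [key] at hb
      refine Run.skip ⟨h12, rfl, ht.setReg (by norm_num), ht3, by simp [r15], by simp [r17],
        by simp [r18], ?_, ?_, ?_, ?_⟩ (by norm_num)
      · simp; omega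
      · simpa using fun p hp => (hlt p hp).trans (Nat.lt_succ_self k)
      · simpa using hinj
      · intro v hv
        simp only [State.setReg_regs, State.setReg_arr]
        rcases Nat.lt_succ_iff_lt_or_eq.1 hv with h | rfl
        · simpa using hiff v h
        · simpa [hb] using hfresh
    · rw [key] at hb
      refine Run.seq (B₁ := 10) (B₂ := 10) ?_ (by norm_num)
      refine Run.store (value_adr hS (hs.reg2' ht.kept) (k := 4) (x := t.regs 16) (by norm_num)
        rfl (by omega)) (show (Expr.reg 12).value w t = k from h12) ?_
        (by simp [Expr.cost, Expr.adr])
      have a1 := ht.setMem (k := 4) (x := t.regs 16) (y := k) hN (by omega) (by norm_num)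
        (by norm_num) (by omega)
      refine Run.assign (x := t.regs 16 + 1) (value_add rfl (value_const (by omega))
        (by omega)) ⟨by simp [h12], by simp, (a1.setReg (by norm_num)).setReg (by norm_num),
          fun v hv => ?_, by simp [r15], by simp [r17], by simp [r18], ?_, ?_, ?_, ?_⟩
        (by simp [Expr.cost])
      · simp only [State.setReg_arr]
        rw [State.setMem_arr _ (by omega) (by omega), if_neg (by omega), ht3 v hv]
      · simp; omega
      all_goals
        have hQ : ∀ p < t.regs 16 + 1, (t.setMem (4 * S + t.regs 16) k).arr S 4 p =
            if p = t.regs 16 then k else t.arr S 4 p := by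
          intro p hp
          rw [State.setMem_arr _ (by omega) (by omega)]; simp
        simp only [State.setReg_arr, State.setReg_regs, if_true,
          show (16 : ℕ) ≠ 12 by norm_num, if_false]
      · intro p hp
        rw [hQ p hp]
        split_ifs with h
        · omega
        · have := hlt p (by omega); omega
      · intro p hp q hq
        rw [hQ p hp, hQ q hq]
        split_ifs with h h' h'
        · omega
        · exact fun h2 => absurd h2.symm (hfresh q (by omega))
        · exact fun h2 => absurd h2 (hfresh p (by omega))
        · exact hinj p (by omega) q (by omega)
      · intro v hv
        rcases Nat.lt_succ_iff_lt_or_eq.1 hv with h | rfl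
        · rw [hiff v h]
          constructor
          · rintro ⟨p, hp, h1⟩
            exact ⟨p, by omega, by rw [hQ p (by omega), if_neg (by omega), h1]⟩
          · rintro ⟨p, hp, h1⟩
            rw [hQ p hp] at h1
            split_ifs at h1 with h2
            · omega
            · exact ⟨p, by omega, h1⟩
        · simp only [hb, true_iff]
          exact ⟨t.regs 16, by omega, by rw [hQ _ (by omega), if_pos rfl]⟩

/-- The invariant of the main loop of the sorting phase. -/
structure SortInv (S N m : ℕ) (T H : ℕ → ℕ) (s : State) (k : ℕ) (t : State) : Prop where
  lists : Lists S N m T s m t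
  kahn : KahnInv T H N m (t.arr S 3) (t.arr S 4) (t.arr S 5) (t.regs 15) (t.regs 16) (t.regs 17)
    (t.regs 18)
  bound : k + (t.regs 15 + t.regs 18) = N + m

theorem SortSetup.run_popVertex {k : ℕ} (ht : SortInv S N m T H s k t) (h17 : t.regs 17 = 0)
    (hq : t.regs 15 < t.regs 16) :
    Run w ω popVertex t 18 fun u => ∃ k' < k, SortInv S N m T H s k' u := by
  have hS := hs.hS
  have hN := hs.hN
  have hk := ht.kahn
  have hqt := hk.qt_le
  have hQ := hk.Q_lt _ hq
  rw [h17] at hk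
  have r2 := hs.reg2' ht.lists.kept
  refine Run.seq (B₁ := 12) (B₂ := 6) ?_ (by norm_num)
  refine Run.assign (x := lastOut T (t.arr S 4 (t.regs 15)) m)
    ((value_ld hS r2 (x := t.arr S 4 (t.regs 15)) (by norm_num)
      (value_ld hS r2 (by norm_num) rfl (by omega)) (by omega)).trans
      (ht.lists.first _ hQ)) ?_ (by simp [Expr.cost, Expr.ld, Expr.adr])
  refine Run.assign (x := t.regs 15 + 1) (value_add (by simp [Expr.value]) (value_const (by omega))
    (by omega)) ?_ (by simp [Expr.cost])
  have hb := ht.bound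
  have ho := hk.out_le
  exact ⟨k - 1, by omega, (ht.lists.setReg (by norm_num)).setReg (by norm_num),
    by simpa using hk.pop hq, by simp; omega⟩

theorem SortSetup.run_emitEdge {k : ℕ} (ht : SortInv S N m T H s k t) (h17 : t.regs 17 ≠ 0) :
    Run w ω emitEdge t 90 fun u => ∃ k' < k, SortInv S N m T H s k' u := by
  have hS := hs.hS
  have hN := hs.hN
  have hm := hs.hm
  have hk := ht.kahn
  have hqt := hk.qt_le
  have hol := hk.out_lt h17 hs.hT
  have hb := ht.bound
  have hqh := hk.qh_le
  obtain ⟨hq0, hem, hTe⟩ := hk.cur h17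
  set e := t.regs 17 with he
  have hHe := hs.hH (e - 1) (by omega)
  have r2 := hs.reg2' ht.lists.kept
  have hdeg : ∀ v < N, t.arr S 3 v = pendingIn H m (t.arr S 5) (t.regs 18) v := hk.deg_eq
  have hdle : t.arr S 3 (H (e - 1)) ≤ m := by
    rw [hdeg _ hHe]
    exact (Finset.card_filter_le (Finset.range m) _).trans (by simp)
  -- The current edge is itself pending at its head, so the decrement below cannot wrap around.
  have hdpos : 1 ≤ t.arr S 3 (H (e - 1)) := by
    obtain ⟨-, -, a3, -⟩ := hk.emit_aux (σ' := fun k => if k = t.regs 18 then e - 1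
      else t.arr S 5 k) h17 hs.hT (fun k hk => by simp [hk.ne]) (by simp)
    rw [a3 _ hHe]; simp
  refine Run.seq (B₁ := 10) (B₂ := 80) ?_ (by norm_num)
  refine Run.store (x := e - 1) (value_adr hS r2 (k := 5) (x := t.regs 18) (by norm_num) rfl
    (by omega)) (value_sub rfl (value_const (by omega)) (by omega) (by omega)) ?_
    (by simp [Expr.cost, Expr.adr])
  have a1 := ht.lists.setMem (k := 5) (x := t.regs 18) (y := e - 1) hN (by omega) (by norm_num)
    (by norm_num) (by omega)
  refine Run.seq (B₁ := 4) (B₂ := 76) ?_ (by norm_num)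
  refine Run.assign (x := t.regs 18 + 1) (value_add rfl (value_const (by omega))
    (by omega)) ?_ (by simp [Expr.cost])
  have a2 := a1.setReg (r := 18) (x := t.regs 18 + 1) (by norm_num)
  refine Run.seq (B₁ := 12) (B₂ := 64) ?_ (by norm_num)
  refine Run.assign (x := H (e - 1)) ((hs.value_input a2.kept (r := 17) (k := e)
    (by simp [he]) (by omega) (by norm_num)).trans ?_) ?_ (by simp [Expr.cost, Expr.ld, Expr.adr])
  -- Register `17` holds the edge number plus one, hence the offset 2 instead of 4.
  · rw [show 2 + 2 * e = 4 + 2 * (e - 1) by omega]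
    exact hs.head _ (by omega)
  have a3 := a2.setReg (r := 19) (x := H (e - 1)) (by norm_num)
  refine Run.seq (B₁ := 12) (B₂ := 52) ?_ (by norm_num)
  refine Run.assign (x := lastOut T (T (e - 1)) (e - 1)) ((value_ld hS (hs.reg2' a3.kept)
    (x := e - 1) (by norm_num) (value_sub (by simp [Expr.value, he]) (value_const (by omega))
      (by omega) (by omega)) (by omega)).trans (a3.next _ (by omega))) ?_
    (by simp [Expr.cost, Expr.ld, Expr.adr])
  have a4 := a3.setReg (r := 17) (x := lastOut T (T (e - 1)) (e - 1)) (by norm_num)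
  refine Run.seq (B₁ := 20) (B₂ := 32) ?_ (by norm_num)
  refine Run.store (x := t.arr S 3 (H (e - 1)) - 1) (value_adr hS (hs.reg2' a4.kept) (k := 3)
    (x := H (e - 1)) (by norm_num) (by simp [Expr.value]) (by omega))
    (value_sub ((value_ld hS (hs.reg2' a4.kept) (x := H (e - 1)) (by norm_num)
      (by simp [Expr.value]) (by omega)).trans ?_) (value_const (by omega)) (by omega)
      (by omega)) ?_ (by simp [Expr.cost, Expr.ld, Expr.adr])
  · simp only [State.setReg_arr]
    rw [State.setMem_arr _ (by omega) (by omega), if_neg (by omega)]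
  have a5 := a4.setMem (k := 3) (x := H (e - 1)) (y := t.arr S 3 (H (e - 1)) - 1) hN (by omega)
    (by norm_num) (by norm_num) (by omega)
  set u := ((((t.setMem (5 * S + t.regs 18) (e - 1)).setReg 18 (t.regs 18 + 1)).setReg 19
    (H (e - 1))).setReg 17 (lastOut T (T (e - 1)) (e - 1))).setMem (3 * S + H (e - 1))
      (t.arr S 3 (H (e - 1)) - 1) with hu
  have u15 : u.regs 15 = t.regs 15 := by simp [hu]
  have u16 : u.regs 16 = t.regs 16 := by simp [hu]
  have u17 : u.regs 17 = lastOut T (T (e - 1)) (e - 1) := by simp [hu]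
  have u18 : u.regs 18 = t.regs 18 + 1 := by simp [hu]
  have u19 : u.regs 19 = H (e - 1) := by simp [hu]
  have u3 : ∀ v < N, u.arr S 3 v =
      if v = H (e - 1) then t.arr S 3 v - 1 else t.arr S 3 v := by
    intro v hv
    rw [hu, State.setMem_arr _ (by omega) (by omega)]
    simp only [State.setReg_arr, true_and]
    rw [State.setMem_arr _ (by omega) (by omega), if_neg (by omega : ¬(3 = 5 ∧ v = t.regs 18))]
    split_ifs with h
    · rw [h]
    · rfl
  have u4 : ∀ p < S, u.arr S 4 p = t.arr S 4 p := by
    intro p hp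
    rw [hu, State.setMem_arr _ (by omega) (by omega), if_neg (by omega)]
    simp only [State.setReg_arr]
    rw [State.setMem_arr _ (by omega) (by omega), if_neg (by omega)]
  have u5 : ∀ p < S, u.arr S 5 p = if p = t.regs 18 then e - 1 else t.arr S 5 p := by
    intro p hp
    rw [hu, State.setMem_arr _ (by omega) (by omega), if_neg (by omega)]
    simp only [State.setReg_arr]
    rw [State.setMem_arr _ (by omega) (by omega)]
    simp
  have key := value_ld hS (hs.reg2' a5.kept) (k := 3) (by norm_num)
    (show (Expr.reg 19).value w u = H (e - 1) from u19) (by omega)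
  refine Run.cond (B := 20) (fun hb' => ?_) (fun hb' => ?_)
    (by simp [Expr.cost, Expr.ld, Expr.adr])
  · rw [key] at hb'
    refine Run.skip ⟨k - 1, by omega, a5, ?_, by rw [u15, u18]; omega⟩ (by norm_num)
    have := hk.emit (σ' := u.arr S 5) (deg' := u.arr S 3) h17 hs.hT
      (fun p hp => by rw [u5 p (by omega), if_neg (by omega)]) (by rw [u5 _ (by omega), if_pos rfl])
      u3 hb'
    rw [u15, u16, u17, u18]
    -- The abstract step keeps the old queue function; in memory the queue agrees with it only
    -- inside array `4`, which covers all positions the invariant mentions.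
    have h4 : ∀ p < t.regs 16, u.arr S 4 p = t.arr S 4 p := fun p hp => u4 p (by omega)
    exact { this with
      Q_lt := fun p hp => by rw [h4 p hp]; exact this.Q_lt p hp
      Q_inj := fun p hp q hq => by rw [h4 p hp, h4 q hq]; exact this.Q_inj p hp q hq
      Q_iff := fun v hv => by
        rw [this.Q_iff v hv]
        exact exists_congr fun p => and_congr_right fun hp => by rw [h4 p hp]
      listed := fun f hf => by
        rw [this.listed f hf, h4 _ (by omega)]
        exact or_congr (exists_congr fun p => and_congr_right fun hp => by rw [h4 p (by omega)])
          Iff.rfl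
      cur := fun h => by rw [h4 _ (by omega)]; exact this.cur h }
  · rw [key] at hb'
    refine Run.seq (B₁ := 10) (B₂ := 10) ?_ (by norm_num)
    refine Run.store (value_adr hS (hs.reg2' a5.kept) (k := 4) (x := t.regs 16) (by norm_num)
      u16 (by omega)) (show (Expr.reg 19).value w u = H (e - 1) from u19) ?_
      (by simp [Expr.cost, Expr.adr])
    have a6 := a5.setMem (k := 4) (x := t.regs 16) (y := H (e - 1)) hN (by omega) (by norm_num)
      (by norm_num) (by omega)
    refine Run.assign (x := t.regs 16 + 1) (value_add u16 (value_const (by omega)) (by omega))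
      ⟨k - 1, by omega, a6.setReg (by norm_num), ?_, by simp [u15, u18]; omega⟩ (by simp [Expr.cost])
    set u' := u.setMem (4 * S + t.regs 16) (H (e - 1)) with hu'
    have v3 : ∀ v < N, u'.arr S 3 v = u.arr S 3 v := fun v hv => by
      rw [hu', State.setMem_arr _ (by omega) (by omega), if_neg (by omega)]
    have v4 : ∀ p < S, u'.arr S 4 p = if p = t.regs 16 then H (e - 1) else t.arr S 4 p := by
      intro p hp
      rw [hu', State.setMem_arr _ (by omega) (by omega), u4 p hp]; simp
    have v5 : ∀ p < S, u'.arr S 5 p = u.arr S 5 p := fun v hv => by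
      rw [hu', State.setMem_arr _ (by omega) (by omega), if_neg (by omega)]
    have := hk.emit_push (σ' := u'.arr S 5) (deg' := u'.arr S 3) (Q' := u'.arr S 4) h17 hs.hT hs.hH
      (fun p hp => by rw [v5 p (by omega), u5 p (by omega), if_neg (by omega)])
      (by rw [v5 _ (by omega), u5 _ (by omega), if_pos rfl])
      (fun v hv => by rw [v3 v hv, u3 v hv]) (by rw [v3 _ hHe, hb'])
      (fun p hp => by rw [v4 p (by omega), if_neg (by omega)])
      (by rw [v4 _ (by omega), if_pos rfl])
    simpa [hu', u15, u17, u18] using this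

theorem SortSetup.run_sortEdges (hwf : WellFounded (EdgeRel T H m))
    (h1 : ∀ u < N, s.arr S 1 u = 0) (h3 : ∀ u < N, s.arr S 3 u = 0)
    (h15 : s.regs 15 = 0) (h16 : s.regs 16 = 0) (h17 : s.regs 17 = 0) (h18 : s.regs 18 = 0) :
    Run w ω sortEdges s (200 * (N + m) + 30) fun t => Kept S s t ∧
      IsTopOrder T H m (t.arr S 5) := by
  have hS := hs.hS
  have hN := hs.hN
  have hm := hs.hm
  refine Run.seq (B₁ := 98 * m + 6) (B₂ := 98 * m + 160 * N + 20) ?_ (by omega)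
  refine (hs.run_buildLists h1 h3 h15 h16 h17 h18).mono le_rfl ?_
  rintro t ⟨ht, ht3, r15, r16, r17, r18⟩
  refine Run.seq (B₁ := 58 * N + 6) (B₂ := 98 * (N + m) + 6) ?_ (by omega)
  refine (hs.run_initQueue ht ht3 r15 r16 r17 r18).mono le_rfl ?_
  rintro t ⟨ht, ht3, r15, r17, r18, hlt, hinj, hiff⟩
  have hval : ∀ t : State, (Expr.bin .lor (.reg 17) (.bin .lt (.reg 15) (.reg 16))).value w t = 0 ↔
      t.regs 17 = 0 ∧ ¬ t.regs 15 < t.regs 16 := by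
    intro t
    simp only [Expr.value, BinOp.apply, Nat.or_eq_zero_iff]
    split_ifs with h <;> simp [h]
  -- Each iteration either pops a vertex or lists an edge, so `N + m` iterations suffice.
  refine Run.loop (B := 92) (SortInv S N m T H s) ?_ ?_ (k := N + m) ⟨ht, ?_, ?_⟩
    (by simp [Expr.cost]; omega)
  · intro k t ht hb
    rw [Ne, hval] at hb
    refine Run.cond (B := 90) (fun hb' => hs.run_emitEdge ht hb') (fun hb' => ?_)
      (by simp [Expr.cost])
    refine (hs.run_popVertex ht hb' ?_).mono (by norm_num) fun _ => id
    by_contra hc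
    exact hb ⟨hb', hc⟩
  · intro k t ht hb
    obtain ⟨b1, b2⟩ := (hval t).1 hb
    have hk := ht.kahn
    have : t.regs 16 = t.regs 15 := le_antisymm (by omega) hk.qh_le
    rw [b1, this] at hk
    exact ⟨ht.lists.kept, hk.isTopOrder hs.hT hwf⟩
  · rw [r15, r17, r18]
    exact KahnInv.init ht3 hlt hinj fun v hv => by rw [ht3 v hv]; exact hiff v hv
  · rw [r15, r18]; ring

end

end WordRAM

/-! ### Concentration of the numbers of hits -/

open MeasureTheory ProbabilityTheory

/-- Hoeffding's inequality for the number of events that occur among `n` independent events of the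
same probability. -/
theorem measureReal_count_deviation_le {Ω : Type*} [MeasurableSpace Ω] {μ : Measure Ω}
    [IsProbabilityMeasure μ] {A : ℕ → Set Ω} (hA : ∀ r, MeasurableSet (A r)) (hind : iIndepSet A μ)
    {p : ℝ} (hp : ∀ r, μ.real (A r) = p) (c : Ω → ℕ → ℕ)
    (hc : ∀ ω n, (c ω n : ℝ) = ∑ r ∈ Finset.range n, (A r).indicator (fun _ => (1 : ℝ)) ω)
    {n : ℕ} (hn : 0 < n) {η : ℝ} (hη : 0 ≤ η) :
    μ.real {ω | η < |(c ω n : ℝ) / n - p|} ≤ 2 * Real.exp (-2 * η ^ 2 * n) := by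
  set X : ℕ → Ω → ℝ := fun r => (A r).indicator fun _ => (1 : ℝ) with hX
  have hn' : (0 : ℝ) < n := by exact_mod_cast hn
  have hmeas : ∀ r, Measurable (X r) := fun r => measurable_const.indicator (hA r)
  have hint : ∀ r, ∫ ω, X r ω ∂μ = p := fun r => by
    rw [← hp r]
    exact integral_indicator_one (hA r)
  have hindX : iIndepFun X μ := hind.iIndepFun_indicator
  have hsub : ∀ r, HasSubgaussianMGF (fun ω => X r ω - p) ((‖(1 : ℝ) - 0‖₊ / 2) ^ 2) μ := by
    intro r
    rw [← hint r]
    refine hasSubgaussianMGF_of_mem_Icc (hmeas r).aemeasurable (ae_of_all _ fun ω => ?_)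
    by_cases h : ω ∈ A r <;> simp [hX, h]
  -- The second tail comes from the same one-sided inequality applied to the negated deviations.
  have hsub' : ∀ r, HasSubgaussianMGF (fun ω => -(X r ω - p)) ((‖(1 : ℝ) - 0‖₊ / 2) ^ 2) μ :=
    fun r => (hsub r).neg
  have hind1 : iIndepFun (fun r ω => X r ω - p) μ :=
    hindX.comp (fun _ x => x - p) fun _ => by fun_prop
  have hind2 : iIndepFun (fun r ω => -(X r ω - p)) μ :=
    hindX.comp (fun _ x => -(x - p)) fun _ => by fun_prop
  have h1 := HasSubgaussianMGF.measure_sum_range_ge_le_of_iIndepFun hind1 (n := n)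
    (fun r _ => hsub r) (ε := η * n) (by positivity)
  have h2 := HasSubgaussianMGF.measure_sum_range_ge_le_of_iIndepFun hind2 (n := n)
    (fun r _ => hsub' r) (ε := η * n) (by positivity)
  -- Variables with values in an interval of length 1 have variance proxy 1/4.
  have hexp : -(η * n) ^ 2 / (2 * n * (((‖(1 : ℝ) - 0‖₊ / 2) ^ 2 : NNReal) : ℝ)) =
      -2 * η ^ 2 * n := by
    simp only [sub_zero, nnnorm_one, NNReal.coe_pow, NNReal.coe_div, NNReal.coe_one,
      NNReal.coe_ofNat]
    field_simp
  rw [hexp] at h1 h2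
  refine le_trans (measureReal_mono (s₂ := {ω | η * n ≤ ∑ i ∈ Finset.range n, (X i ω - p)} ∪
    {ω | η * n ≤ ∑ i ∈ Finset.range n, -(X i ω - p)}) ?_) ((measureReal_union_le _ _).trans
      (by linarith))
  intro ω hω
  simp only [Set.mem_ofPred_eq, Set.mem_union] at hω ⊢
  have h3 : ∑ i ∈ Finset.range n, (X i ω - p) = ((c ω n : ℝ) / n - p) * n := by
    rw [Finset.sum_sub_distrib, hc]
    simp only [Finset.sum_const, Finset.card_range, nsmul_eq_mul, hX]
    field_simp
  rw [Finset.sum_neg_distrib, h3]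
  rcases lt_abs.1 hω with h | h
  · left; nlinarith
  · right; nlinarith

namespace WordRAM

/-! ### Sampling probabilities and independence of disjoint blocks of words. -/

variable {w : ℕ}

/-- As `2 ^ i` divides `2 ^ w`, exactly `2 ^ (w - i)` words are divisible by it; the sampling
probability is therefore exactly 2^(-i). -/
theorem card_fin_mod_ne_zero {i : ℕ} (hi : i ≤ w) :
    Fintype.card {x : Fin (2 ^ w) | (x : ℕ) % 2 ^ i ≠ 0} + 2 ^ (w - i) = 2 ^ w := by
  have h1 : (Finset.univ.filter fun x : Fin (2 ^ w) => (x : ℕ) % 2 ^ i = 0).card = 2 ^ (w - i) := by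
    have h2 := Nat.count_modEq_card (2 ^ w) (r := 2 ^ i) (by positivity) 0
    rw [Nat.zero_mod, Nat.mod_eq_zero_of_dvd (pow_dvd_pow 2 hi), Nat.pow_div hi (by norm_num),
      Nat.count_eq_card_filter_range] at h2
    simp only [lt_self_iff_false, if_false, add_zero] at h2
    rw [← h2]
    refine Finset.card_bij (fun x _ => (x : ℕ)) (fun x hx => ?_) (fun x _ y _ h => Fin.ext h)
      fun y hy => ?_
    · exact Finset.mem_filter.2 ⟨Finset.mem_range.2 x.2, by simpa [Nat.ModEq] using hx⟩
    · simp only [Finset.mem_filter, Finset.mem_range] at hy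
      exact ⟨⟨y, hy.1⟩, by simpa [Nat.ModEq] using hy.2, rfl⟩
  have h3 := Finset.card_filter_add_card_filter_not (s := (Finset.univ : Finset (Fin (2 ^ w))))
    fun x => (x : ℕ) % 2 ^ i = 0
  rw [h1, Finset.card_univ, Fintype.card_fin] at h3
  rw [Fintype.card_of_subtype (Finset.univ.filter fun x : Fin (2 ^ w) => ¬ (x : ℕ) % 2 ^ i = 0)
    (by simp)]
  omega

instance (w : ℕ) : IsProbabilityMeasure (randomWords w) := by
  unfold randomWords; infer_instance

theorem uniform_mod_ne_zero {i : ℕ} (hi : i ≤ w) :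
    (PMF.uniformOfFintype (Fin (2 ^ w))).toMeasure {x | (x : ℕ) % 2 ^ i ≠ 0} =
      ENNReal.ofReal (1 - 1 / 2 ^ i) := by
  rw [PMF.toMeasure_uniformOfFintype_apply _ (MeasurableSet.of_discrete)]
  have h := card_fin_mod_ne_zero hi
  have h' : (Fintype.card {x : Fin (2 ^ w) | (x : ℕ) % 2 ^ i ≠ 0} : ℝ) = 2 ^ w - 2 ^ (w - i) := by
    rw [eq_sub_iff_add_eq]; exact_mod_cast h
  have h2 : (2 : ℝ) ^ w = 2 ^ (w - i) * 2 ^ i := by rw [← pow_add]; congr 1; omega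
  have h3 : (1 : ℝ) - 1 / 2 ^ i = (Fintype.card {x : Fin (2 ^ w) | (x : ℕ) % 2 ^ i ≠ 0} : ℝ) /
      (Fintype.card (Fin (2 ^ w)) : ℝ) := by
    rw [h', Fintype.card_fin]
    push_cast
    rw [h2]
    field_simp
  rw [h3, ENNReal.ofReal_div_of_pos (by simp), ENNReal.ofReal_natCast, ENNReal.ofReal_natCast]

/-- The event that none of the words with numbers in `b` is divisible by `2 ^ i`. -/
def missEvent (w i : ℕ) (b : Finset ℕ) : Set (ℕ → Fin (2 ^ w)) :=
  (b : Set ℕ).pi fun _ => {x | (x : ℕ) % 2 ^ i ≠ 0}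

theorem measurableSet_missEvent (w i : ℕ) (b : Finset ℕ) : MeasurableSet (missEvent w i b) :=
  MeasurableSet.pi b.countable_toSet fun _ _ => MeasurableSet.of_discrete

/-- Misses, unlike hits, are boxes in the product space, so their probabilities are products of
marginals; independence over disjoint blocks follows in the same way. -/
theorem randomWords_missEvent {i : ℕ} (hi : i ≤ w) (b : Finset ℕ) :
    randomWords w (missEvent w i b) = ENNReal.ofReal (1 - 1 / 2 ^ i) ^ b.card := by
  rw [randomWords, missEvent, Measure.infinitePi_pi _ fun _ _ => MeasurableSet.of_discrete]
  simp [uniform_mod_ne_zero hi]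

theorem iIndepSet_missEvent {i : ℕ} (hi : i ≤ w) {b : ℕ → Finset ℕ}
    (hb : Pairwise fun r s => Disjoint (b r) (b s)) :
    iIndepSet (fun r => missEvent w i (b r)) (randomWords w) := by
  classical
  rw [iIndepSet_iff_meas_biInter fun r => measurableSet_missEvent w i (b r)]
  intro s
  have h : ⋂ r ∈ s, missEvent w i (b r) = missEvent w i (s.biUnion b) := by
    ext ω
    simp only [missEvent, Set.mem_iInter, Set.mem_pi, Finset.mem_coe, Finset.mem_biUnion]
    constructor
    · rintro h j ⟨r, hr, hj⟩; exact h r hr j hj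
    · intro h r hr j hj; exact h j ⟨r, hr, hj⟩
  rw [h, randomWords_missEvent hi, Finset.card_biUnion fun r _ t _ hrt => hb hrt,
    Finset.prod_congr rfl fun r _ => randomWords_missEvent hi (b r), Finset.prod_pow_eq_pow_sum]

open Classical in
/-- The number of items whose owners reach `v`. -/
noncomputable def itemCount (T H : ℕ → ℕ) (m : ℕ) (own : ℕ → ℕ) (J v : ℕ) : ℕ :=
  ((Finset.range J).filter fun j => Relation.ReflTransGen (EdgeRel T H m) (own j) v).card

/-- A repetition misses `v` exactly if none of the words of the items reaching `v` is divisible by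
`2 ^ i`. Misses in different repetitions are independent, and the frequencies of hits and misses
have the same absolute deviation. -/
theorem measureReal_hitCount_deviation_le {i R : ℕ} (hi : i ≤ w) (hR : 0 < R) (T H : ℕ → ℕ) (m : ℕ)
    (own : ℕ → ℕ) (J dr v : ℕ) {η : ℝ} (hη : 0 ≤ η) :
    (randomWords w).real {ω | η < |(hitCount ω T H m own J R dr i R v : ℝ) / R -
      hitProb (itemCount T H m own J v) i|} ≤ 2 * Real.exp (-2 * η ^ 2 * R) := by
  classical
  set F := (Finset.range J).filter fun j => Relation.ReflTransGen (EdgeRel T H m) (own j) v with hF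
  set b : ℕ → Finset ℕ := fun r => F.image fun j => dr + (i * R + r) * J + j with hb
  have hJF : ∀ j ∈ F, j < J := fun j hj => by simpa using (Finset.mem_filter.1 hj).1
  have hcard : ∀ r, (b r).card = itemCount T H m own J v := fun r =>
    Finset.card_image_of_injective _ fun x y h => by simpa using h
  -- Item numbers are below `J`, so the quotient of the offset from `dr` by `J` determines the
  -- repetition.
  have hdisj : Pairwise fun r s => Disjoint (b r) (b s) := by
    intro r s hrs
    rw [Finset.disjoint_left]
    simp only [hb, Finset.mem_image]
    rintro x ⟨j, hj, rfl⟩ ⟨k, hk, h⟩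
    have h1 := hJF j hj
    have h2 := hJF k hk
    have h3 : (k + J * (i * R + s)) / J = (j + J * (i * R + r)) / J := by
      congr 1; linarith
    rw [Nat.add_mul_div_left _ _ (by omega), Nat.add_mul_div_left _ _ (by omega),
      Nat.div_eq_of_lt h1, Nat.div_eq_of_lt h2] at h3
    omega
  have hmiss : ∀ r (ω : ℕ → Fin (2 ^ w)), ω ∈ missEvent w i (b r) ↔ ¬ HitFrom T H m
      (fun u => ∃ j < J, own j = u ∧ (ω (dr + (i * R + r) * J + j) : ℕ) % 2 ^ i = 0) v := by
    intro r ω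
    simp only [missEvent, Set.mem_pi, Finset.mem_coe, hb, Finset.mem_image, HitFrom,
      Set.mem_ofPred_eq]
    constructor
    · rintro h ⟨u, ⟨j, hj, rfl, h1⟩, h2⟩
      exact h _ ⟨j, by simp [hF, hj, h2], rfl⟩ h1
    · rintro h _ ⟨j, hj, rfl⟩ h1
      rw [hF, Finset.mem_filter, Finset.mem_range] at hj
      exact h ⟨_, ⟨j, hj.1, rfl, h1⟩, hj.2⟩
  set c : (ℕ → Fin (2 ^ w)) → ℕ → ℕ := fun ω n => Nat.count (fun r => ω ∈ missEvent w i (b r)) n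
    with hc
  have hsum : ∀ ω n, (c ω n : ℝ) =
      ∑ r ∈ Finset.range n, (missEvent w i (b r)).indicator (fun _ => (1 : ℝ)) ω := by
    intro ω n
    simp [hc, Nat.count_eq_card_filter_range, Set.indicator_apply]
  have htot : ∀ ω n, (hitCount ω T H m own J R dr i n v : ℝ) = n - c ω n := by
    intro ω n
    rw [eq_sub_iff_add_eq, ← Nat.cast_add, Nat.cast_inj]
    induction n with
    | zero => simp [hc, hitCount]
    | succ n ih =>
      simp only [hc, hitCount, Nat.count_succ, hmiss] at ih ⊢
      split_ifs <;> omega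
  have hbase : (0 : ℝ) ≤ 1 - 1 / 2 ^ i := by
    rw [sub_nonneg, div_le_one (by positivity)]; exact one_le_pow₀ (by norm_num)
  have hmain := measureReal_count_deviation_le (μ := randomWords w)
    (fun r => measurableSet_missEvent w i (b r)) (iIndepSet_missEvent hi hdisj)
    (p := (1 - 1 / 2 ^ i) ^ itemCount T H m own J v)
    (fun r => by
      rw [Measure.real, randomWords_missEvent hi, hcard r, ENNReal.toReal_pow,
        ENNReal.toReal_ofReal hbase]) c hsum hR hη
  refine le_trans (le_of_eq ?_) hmain
  congr 1
  ext ω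
  have hR' : (R : ℝ) ≠ 0 := by exact_mod_cast hR.ne'
  rw [Set.mem_ofPred_eq, Set.mem_ofPred_eq, htot, hitProb, sub_div, div_self hR', ← abs_neg]
  ring_nf


/-! ### The whole algorithm -/

/-- Read the numbers of vertices and edges into the registers `3` and `4`, and put the length of
the binary representation of `n` into register `5`, the length of the arrays into register `2`, and
the numbers of repetitions and levels and the threshold into the registers `6`, `7` and `8`. -/
def setup (a b c : ℕ) : Prog :=
  .seq (.assign 3 (.load (.const 1)))
  (.seq (.assign 4 (.load (.const 2)))
  (.seq (.assign 9 (.load (.const 0)))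
  (.seq (.loop (.reg 9) (.seq (.assign 9 (.bin .div (.reg 9) (.const 2)))
    (.assign 5 (.bin .add (.reg 5) (.const 1)))))
  (.seq (.assign 2 (.bin .shl (.const 1) (.bin .mul (.const 3) (.reg 5))))
  (.seq (.assign 6 (.bin .mul (.const a) (.reg 5)))
  (.seq (.assign 7 (.bin .mul (.const b) (.reg 5)))
    (.assign 8 (.bin .mul (.const c) (.reg 5)))))))))

/-- The head of the edge whose number is in register `12`. -/
def headOwner : Expr := .ld 0 (.bin .add (.const 4) (.bin .mul (.const 2) (.reg 12)))

/-- The algorithm: sort the edges, estimate the numbers of ancestors and the numbers of edges that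
they induce. -/
def algorithm (a b c : ℕ) : Prog :=
  .seq (setup a b c) (.seq sortEdges
  (.seq (.assign 20 (.reg 3)) (.seq (estimate (.reg 12) 8)
  (.seq (.assign 20 (.reg 4)) (.seq (estimate headOwner 9)
  (.seq (.assign 0 (.adr 8 (.const 0))) (.assign 1 (.adr 9 (.const 0)))))))))

variable {w : ℕ} {ω : ℕ → Fin (2 ^ w)}

theorem size_eq_size_half_add_one {n : ℕ} (h : n ≠ 0) : n.size = (n / 2).size + 1 := by
  conv_lhs => rw [← Nat.bit_bodd_div2 n]
  rw [Nat.size_bit (by rwa [Nat.bit_bodd_div2]), Nat.div2_val]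

/-- The bit length of `n`, which replaces the logarithm, is found by repeated halving; the bit
length of register `9` counts the remaining iterations. -/
theorem run_setup {a b c n N m : ℕ} {s : State} (h5 : s.regs 5 = 0) (h0 : s.mem 0 = n)
    (h1 : s.mem 1 = N) (h2 : s.mem 2 = m) (hw : 3 * n.size < w) (hw1 : 1 < w)
    (ha : a < 2 ^ w) (hb : b < 2 ^ w) (hc : c < 2 ^ w)
    (ha' : a * n.size < 2 ^ w) (hb' : b * n.size < 2 ^ w) (hc' : c * n.size < 2 ^ w) :
    Run w ω (setup a b c) s (10 * n.size + 40) fun t => t.mem = s.mem ∧ t.drawn = s.drawn ∧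
      (∀ r, 10 ≤ r → t.regs r = s.regs r) ∧ t.regs 2 = 2 ^ (3 * n.size) ∧ t.regs 3 = N ∧
      t.regs 4 = m ∧ t.regs 6 = a * n.size ∧ t.regs 7 = b * n.size ∧ t.regs 8 = c * n.size := by
  have h4w : 4 ≤ 2 ^ w := by
    calc 4 = 2 ^ 2 := by norm_num
      _ ≤ 2 ^ w := Nat.pow_le_pow_right (by norm_num) hw1
  have hsz : n.size < 2 ^ w := lt_of_le_of_lt (by omega) (Nat.lt_two_pow_self (n := w))
  refine Run.seq (B₁ := 3) (B₂ := 10 * n.size + 37) ?_ (by omega)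
  refine Run.assign (x := N) (by rw [Expr.value, value_const (by omega), h1]) ?_ (by simp [Expr.cost])
  refine Run.seq (B₁ := 3) (B₂ := 10 * n.size + 34) ?_ (by omega)
  refine Run.assign (x := m) (by rw [Expr.value, value_const (by omega)]; exact h2) ?_
    (by simp [Expr.cost])
  refine Run.seq (B₁ := 3) (B₂ := 10 * n.size + 31) ?_ (by omega)
  refine Run.assign (x := n) (by rw [Expr.value, value_const (by omega)]; exact h0) ?_
    (by simp [Expr.cost])
  refine Run.seq (B₁ := 10 * n.size + 2) (B₂ := 29) ?_ (by omega)
  refine Run.loop (B := 8) (fun k t => t.mem = s.mem ∧ t.drawn = s.drawn ∧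
    (∀ r, 10 ≤ r → t.regs r = s.regs r) ∧ t.regs 3 = N ∧ t.regs 4 = m ∧ k = (t.regs 9).size ∧
    k + t.regs 5 = n.size) ?_ ?_ (k := n.size) ?_ (by simp [Expr.cost]; omega)
  · rintro k t ⟨e1, e2, e3, e4, e5, e6, e7⟩ hlp
    have h9 : t.regs 9 ≠ 0 := hlp
    have hk := size_eq_size_half_add_one h9
    refine Run.seq (B₁ := 4) (B₂ := 4) ?_ le_rfl
    refine Run.assign (x := t.regs 9 / 2) ?_ ?_ (by simp [Expr.cost])
    · rw [Expr.value, value_const (by omega)]; rfl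
    refine Run.assign (x := t.regs 5 + 1) (value_add (by simp [Expr.value]) (value_const (by omega))
      (by omega)) ⟨k - 1, by omega, e1, e2, fun r hr => ?_, by simp [e4], by simp [e5], ?_, ?_⟩
      (by simp [Expr.cost])
    · simp [show r ≠ 5 by omega, show r ≠ 9 by omega, e3 r hr]
    · simp; omega
    · simp; omega
  · rintro k t ⟨e1, e2, e3, e4, e5, e6, e7⟩ hlp
    have h9 : t.regs 9 = 0 := hlp
    have h5 : t.regs 5 = n.size := by
      rw [h9, Nat.size_zero] at e6; omega
    refine Run.seq (B₁ := 8) (B₂ := 21) ?_ (by norm_num)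
    refine Run.assign (x := 2 ^ (3 * n.size)) (value_shl_one (value_mul (value_const (by omega)) h5
      ?_) (by omega) hw) ?_ (by simp [Expr.cost])
    · exact hw.trans Nat.lt_two_pow_self
    refine Run.seq (B₁ := 4) (B₂ := 17) ?_ (by norm_num)
    refine Run.assign (x := a * n.size) (value_mul (value_const ha) (by simpa [Expr.value] using h5)
      ha') ?_ (by simp [Expr.cost])
    refine Run.seq (B₁ := 4) (B₂ := 13) ?_ (by norm_num)
    refine Run.assign (x := b * n.size) (value_mul (value_const hb) (by simpa [Expr.value] using h5)
      hb') ?_ (by simp [Expr.cost])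
    refine Run.assign (x := c * n.size) (value_mul (value_const hc) (by simpa [Expr.value] using h5)
      hc') ⟨e1, e2, fun r hr => ?_, by simp, by simp [e4], by simp [e5], by simp, by simp, by simp⟩
      (by simp [Expr.cost])
    simp [show r ≠ 8 by omega, show r ≠ 7 by omega, show r ≠ 6 by omega, show r ≠ 2 by omega,
      e3 r hr]
  · refine ⟨rfl, rfl, fun r hr => ?_, by simp, by simp, by simp, by simp [h5]⟩
    simp [show r ≠ 9 by omega, show r ≠ 4 by omega, show r ≠ 3 by omega]

/-- The word length `w` suffices for the algorithm with the parameters `a`, `b`, `c`. -/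
structure Fits (w a b c n N m : ℕ) : Prop where
  hw : 3 * n.size + 4 ≤ w
  hI : b * n.size ≤ w
  hR : 2 * (a * n.size * 2 ^ (b * n.size)) + 2 * (a * n.size) < 2 ^ w
  hc : c ≤ a
  hn : 1 ≤ n.size
  hN : N < 2 ^ (3 * n.size)
  hm : 2 * m + 4 < 2 ^ (3 * n.size)

theorem run_algorithm {a b c n N m : ℕ} (hf : Fits w a b c n N m) {T H : ℕ → ℕ} {s : State}
    (hs0 : s.mem 0 = n) (hs1 : s.mem 1 = N) (hs2 : s.mem 2 = m)
    (htail : ∀ k < m, s.mem (3 + 2 * k) = T k) (hhead : ∀ k < m, s.mem (4 + 2 * k) = H k)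
    (hzero : ∀ x, 3 + 2 * m ≤ x → s.mem x = 0) (hregs : ∀ r, s.regs r = 0) (hdrawn : s.drawn = 0)
    (hT : ∀ k < m, T k < N) (hH : ∀ k < m, H k < N) (hwf : WellFounded (EdgeRel T H m)) :
    Run w ω (algorithm a b c) s
      (10 * n.size + 200 * (N + m) + 110 +
        b * n.size * (a * n.size * (106 * N + 68 * m + 26) + 58 * N + 30) +
        b * n.size * (a * n.size * (116 * m + 58 * N + 26) + 58 * N + 30)) fun t =>
      ∀ v < N,
        t.mem (t.regs 0 + v) = levelEstimate (a * n.size) (c * n.size)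
          (fun i => hitCount ω T H m id N (a * n.size) 0 i (a * n.size) v) (b * n.size) ∧
        t.mem (t.regs 1 + v) = levelEstimate (a * n.size) (c * n.size)
          (fun i => hitCount ω T H m H m (a * n.size) (b * n.size * (a * n.size) * N) i
            (a * n.size) v) (b * n.size) := by
  obtain ⟨hw, hI, hR, hca, hn1, hN, hm⟩ := hf
  set l := n.size with hl
  set S := 2 ^ (3 * l) with hSdef
  have hS : 16 * S ≤ 2 ^ w := by
    calc 16 * S = 2 ^ (3 * l + 4) := by rw [hSdef, pow_add]; ring
      _ ≤ 2 ^ w := Nat.pow_le_pow_right (by norm_num) hw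
  have hal : a ≤ a * l := Nat.le_mul_of_pos_right _ hn1
  have hcl : c * l ≤ a * l := Nat.mul_le_mul_right _ hca
  have hbl : b ≤ b * l := Nat.le_mul_of_pos_right _ hn1
  have hww : w < 2 ^ w := Nat.lt_two_pow_self
  refine Run.seq (B₁ := 10 * l + 40) (B₂ := 200 * (N + m) + 70 +
        b * l * (a * l * (106 * N + 68 * m + 26) + 58 * N + 30) +
        b * l * (a * l * (116 * m + 58 * N + 26) + 58 * N + 30)) ?_ (by omega)
  refine (run_setup (hregs 5) hs0 hs1 hs2 (by omega) (by omega) (by omega) (by omega) (by omega)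
    (by rw [← hl]; omega) (by rw [← hl]; omega) (by rw [← hl]; omega)).mono le_rfl ?_
  rintro t1 ⟨m1, d1, r1, r2, r3, r4, r6, r7, r8⟩
  rw [← hl] at r2 r6 r7 r8
  have htail1 : ∀ k < m, t1.arr S 0 (3 + 2 * k) = T k := fun k hk => by
    rw [State.arr, m1, zero_mul, zero_add, htail k hk]
  have hhead1 : ∀ k < m, t1.arr S 0 (4 + 2 * k) = H k := fun k hk => by
    rw [State.arr, m1, zero_mul, zero_add, hhead k hk]
  -- The input ends inside block 0, so all working arrays are initially zero.
  have hzero1 : ∀ k, 1 ≤ k → ∀ x, t1.arr S k x = 0 := fun k hk x => by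
    rw [State.arr, m1]
    refine hzero _ ?_
    have := Nat.mul_le_mul_right S hk
    omega
  have hss : SortSetup w S N m T H t1 := ⟨hS, hN, hm, r2, r3, r4, htail1, hhead1, hT, hH⟩
  have hr : ∀ r, 10 ≤ r → t1.regs r = 0 := fun r hr => by rw [r1 r hr, hregs]
  refine Run.seq (B₁ := 200 * (N + m) + 30) (B₂ := 40 +
        b * l * (a * l * (106 * N + 68 * m + 26) + 58 * N + 30) +
        b * l * (a * l * (116 * m + 58 * N + 26) + 58 * N + 30)) ?_ (by omega)
  refine (hss.run_sortEdges hwf (fun u _ => hzero1 1 (by norm_num) u)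
    (fun u _ => hzero1 3 (by norm_num) u) (hr 15 (by norm_num)) (hr 16 (by norm_num))
    (hr 17 (by norm_num)) (hr 18 (by norm_num))).mono le_rfl ?_
  rintro t2 ⟨hk, htop⟩
  have k2 : t2.regs 2 = S := by rw [hk.regs 2 (by norm_num), r2]
  have k3 : t2.regs 3 = N := by rw [hk.regs 3 (by norm_num), r3]
  have k4 : t2.regs 4 = m := by rw [hk.regs 4 (by norm_num), r4]
  refine Run.seq (B₁ := 2) (B₂ := 38 +
        b * l * (a * l * (106 * N + 68 * m + 26) + 58 * N + 30) +
        b * l * (a * l * (116 * m + 58 * N + 26) + 58 * N + 30)) ?_ (by omega)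
  refine Run.assign (x := N) k3 ?_ (by simp [Expr.cost])
  have he1 : EstSetup w S N m (a * l) (b * l) (c * l) N 8 T H (t2.arr S 5) id (.reg 12)
      (t2.setReg 20 N) :=
    { hS := hS, hN := hN, hm := hm, hJ := by omega, hI := hI, hR := hR, hout := .inl rfl
      reg2 := by simp [k2]
      reg3 := by simp [k3]
      reg4 := by simp [k4]
      reg6 := by simp [hk.regs 6 (by norm_num), r6]
      reg7 := by simp [hk.regs 7 (by norm_num), r7]
      reg8 := by simp [hk.regs 8 (by norm_num), r8]
      reg20 := by simp
      tail := fun k hkm => by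
        rw [State.setReg_arr, hk.arr 0 (by norm_num) (.inl rfl) _ (by omega), htail1 k hkm]
      head := fun k hkm => by
        rw [State.setReg_arr, hk.arr 0 (by norm_num) (.inl rfl) _ (by omega), hhead1 k hkm]
      order := fun k hkm => by simp
      hT := hT, hH := hH, top := htop
      own_lt := fun j hj => hj
      own_value := fun t _ _ => rfl
      cost := by simp [Expr.cost] }
  have z : ∀ k < 16, 6 ≤ k → ∀ v < N, (t2.setReg 20 N).arr S k v = 0 := fun k hk16 hk6 v hv => by
    rw [State.setReg_arr, hk.arr k hk16 (.inr hk6) v (by omega), hzero1 k (by omega)]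
  refine Run.seq (B₁ := b * l * (a * l * (106 * N + 68 * m + 26) + 58 * N + 30) + 6) (B₂ := 32 +
        b * l * (a * l * (116 * m + 58 * N + 26) + 58 * N + 30)) ?_ (by omega)
  refine (he1.run_estimate (z 6 (by norm_num) (by norm_num)) (z 7 (by norm_num) (by norm_num))
    (z 8 (by norm_num) (by norm_num))).mono (le_of_eq (by ring)) ?_
  rintro t3 ⟨same3, z6, z7, est3, drawn3⟩
  -- Sorting draws nothing, and the first phase draws a fixed number of words; hence the second
  -- phase starts at the same word in every run.
  have dr0 : (t2.setReg 20 N).drawn = 0 := by rw [State.setReg_drawn, hk.drawn, d1, hdrawn]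
  rw [dr0] at est3 drawn3
  have q : ∀ r < 10, t3.regs r = t2.regs r := fun r hr => by
    rw [same3.regs r (.inl hr), State.setReg_regs, if_neg (by omega)]
  have p : ∀ k < 16, k ≠ 6 → k ≠ 7 → k ≠ 8 → ∀ x < S, t3.arr S k x = t2.arr S k x :=
    fun k a1 a2 a3 a4 x hx => by rw [same3.arr k a1 a2 a3 a4 x hx, State.setReg_arr]
  refine Run.seq (B₁ := 2) (B₂ := 30 +
        b * l * (a * l * (116 * m + 58 * N + 26) + 58 * N + 30)) ?_ (by omega)
  refine Run.assign (x := m) ((q 4 (by norm_num)).trans k4) ?_ (by simp [Expr.cost])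
  have he2 : EstSetup w S N m (a * l) (b * l) (c * l) m 9 T H (t2.arr S 5) H headOwner
      (t3.setReg 20 m) :=
    { hS := hS, hN := hN, hm := hm, hJ := by omega, hI := hI, hR := hR, hout := .inr rfl
      reg2 := by simp [q, k2]
      reg3 := by simp [q, k3]
      reg4 := by simp [q, k4]
      reg6 := by simp [q, hk.regs 6 (by norm_num), r6]
      reg7 := by simp [q, hk.regs 7 (by norm_num), r7]
      reg8 := by simp [q, hk.regs 8 (by norm_num), r8]
      reg20 := by simp
      tail := fun k hkm => by
        rw [State.setReg_arr, p 0 (by norm_num) (by norm_num) (by norm_num) (by norm_num) _ (by omega),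
          hk.arr 0 (by norm_num) (.inl rfl) _ (by omega), htail1 k hkm]
      head := fun k hkm => by
        rw [State.setReg_arr, p 0 (by norm_num) (by norm_num) (by norm_num) (by norm_num) _ (by omega),
          hk.arr 0 (by norm_num) (.inl rfl) _ (by omega), hhead1 k hkm]
      order := fun k hkm => by
        rw [State.setReg_arr, p 5 (by norm_num) (by norm_num) (by norm_num) (by norm_num) _ (by omega)]
      hT := hT, hH := hH, top := htop
      own_lt := hH
      own_value := fun t ht hj => by
        have t2' : t.regs 2 = S := by rw [ht.regs 2 (by norm_num)]; simp [q, k2]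
        rw [headOwner, value_ld hS t2' (by norm_num) (x := 4 + 2 * t.regs 12)
          (value_add (value_const (by omega)) (value_mul (value_const (by omega)) rfl (by omega))
            (by omega)) (by omega),
          ht.arr 0 (by norm_num) (by norm_num) (by norm_num) (by norm_num) _ (by omega),
          State.setReg_arr, p 0 (by norm_num) (by norm_num) (by norm_num) (by norm_num) _ (by omega),
          hk.arr 0 (by norm_num) (.inl rfl) _ (by omega), hhead1 _ hj]
      cost := by simp [headOwner, Expr.ld, Expr.adr, Expr.cost] }
  refine Run.seq (B₁ := b * l * (a * l * (116 * m + 58 * N + 26) + 58 * N + 30) + 6) (B₂ := 24) ?_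
    (by omega)
  refine (he2.run_estimate z6 z7 (fun v hv => ?_)).mono (le_of_eq (by ring)) ?_
  · rw [State.setReg_arr, p 9 (by norm_num) (by norm_num) (by norm_num) (by norm_num) v (by omega),
      hk.arr 9 (by norm_num) (.inr (by norm_num)) v (by omega), hzero1 9 (by norm_num)]
  rintro t4 ⟨same4, -, -, est4, -⟩
  rw [State.setReg_drawn, drawn3, zero_add] at est4
  have hS0 : 0 < S := by omega
  have x2 : t4.regs 2 = S := by rw [same4.regs 2 (by norm_num)]; simp [q, k2]
  refine Run.seq (B₁ := 12) (B₂ := 12) ?_ (by norm_num)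
  refine Run.assign (x := 8 * S + 0) (value_adr hS x2 (by norm_num) (value_const (by omega)) hS0) ?_
    (by simp [Expr.cost, Expr.adr])
  refine Run.assign (x := 9 * S + 0) (value_adr hS (by simpa using x2) (by norm_num)
    (value_const (by omega)) hS0) ?_ (by simp [Expr.cost, Expr.adr])
  intro v hv
  have y8 := (same4.arr 8 (by norm_num) (by norm_num) (by norm_num) (by norm_num) v
    (by omega)).trans (est3 v hv)
  have y9 := est4 v hv
  simp only [State.arr] at y8 y9
  exact ⟨by simpa using y8, by simpa using y9⟩

end WordRAM

/-! ### The input graph -/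

section Graph

variable {N : ℕ} {G : Digraph (Fin N)} {L : List (Fin N × Fin N)}

/-- The tails of the edges in a list. -/
def tailOf (L : List (Fin N × Fin N)) (k : ℕ) : ℕ := (L.map fun e => (e.1 : ℕ)).getD k 0

/-- The heads of the edges in a list. -/
def headOf (L : List (Fin N × Fin N)) (k : ℕ) : ℕ := (L.map fun e => (e.2 : ℕ)).getD k 0

theorem tailOf_eq {k : ℕ} (hk : k < L.length) : tailOf L k = (L[k].1 : ℕ) := by
  simp [tailOf, hk]

theorem headOf_eq {k : ℕ} (hk : k < L.length) : headOf L k = (L[k].2 : ℕ) := by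
  simp [headOf, hk]

theorem getD_flatMap_even (L : List (Fin N × Fin N)) (k : ℕ) :
    (L.flatMap fun e => [(e.1 : ℕ), (e.2 : ℕ)]).getD (2 * k) 0 = tailOf L k := by
  induction L generalizing k with
  | nil => simp [tailOf]
  | cons e L ih =>
    cases k with
    | zero => simp [tailOf]
    | succ k =>
      rw [show 2 * (k + 1) = 2 * k + 1 + 1 by ring]
      simpa [tailOf] using ih k

theorem getD_flatMap_odd (L : List (Fin N × Fin N)) (k : ℕ) :
    (L.flatMap fun e => [(e.1 : ℕ), (e.2 : ℕ)]).getD (2 * k + 1) 0 = headOf L k := by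
  induction L generalizing k with
  | nil => simp [headOf]
  | cons e L ih =>
    cases k with
    | zero => simp [headOf]
    | succ k =>
      rw [show 2 * (k + 1) + 1 = 2 * k + 1 + 1 + 1 by ring]
      simpa [headOf] using ih k

theorem length_encodeInput (n : ℕ) (L : List (Fin N × Fin N)) :
    (encodeInput n N L).length = 3 + 2 * L.length := by
  simp [encodeInput, List.length_flatMap]
  ring

theorem getD_encodeInput_tail (n : ℕ) (L : List (Fin N × Fin N)) (k : ℕ) :
    (encodeInput n N L).getD (3 + 2 * k) 0 = tailOf L k := by
  rw [← getD_flatMap_even, show 3 + 2 * k = 2 * k + 1 + 1 + 1 by ring]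
  simp [encodeInput]

theorem getD_encodeInput_head (n : ℕ) (L : List (Fin N × Fin N)) (k : ℕ) :
    (encodeInput n N L).getD (4 + 2 * k) 0 = headOf L k := by
  rw [← getD_flatMap_odd, show 4 + 2 * k = 2 * k + 1 + 1 + 1 + 1 by ring]
  simp [encodeInput]

theorem edgeRel_iff (hL : G.IsEdgeList L) {x y : ℕ} :
    EdgeRel (tailOf L) (headOf L) L.length x y ↔ ∃ a b : Fin N, G.Adj a b ∧ a = x ∧ b = y := by
  constructor
  · rintro ⟨k, hk, rfl, rfl⟩
    exact ⟨L[k].1, L[k].2, (hL.2 _ _).1 (List.getElem_mem hk), (tailOf_eq hk).symm,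
      (headOf_eq hk).symm⟩
  · rintro ⟨a, b, h, rfl, rfl⟩
    obtain ⟨k, hk, h1⟩ := List.getElem_of_mem ((hL.2 a b).2 h)
    exact ⟨k, hk, by rw [tailOf_eq hk, h1], by rw [headOf_eq hk, h1]⟩

theorem reflTransGen_edgeRel_iff (hL : G.IsEdgeList L) {u v : Fin N} :
    Relation.ReflTransGen (EdgeRel (tailOf L) (headOf L) L.length) u v ↔
      Relation.ReflTransGen G.Adj u v := by
  constructor
  · intro h
    suffices ∀ y : ℕ, Relation.ReflTransGen (EdgeRel (tailOf L) (headOf L) L.length) u y →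
        ∃ b : Fin N, (b : ℕ) = y ∧ Relation.ReflTransGen G.Adj u b by
      obtain ⟨b, hb, h1⟩ := this v h
      rwa [Fin.ext hb] at h1
    intro y h
    induction h with
    | refl => exact ⟨u, rfl, .refl⟩
    | tail _ h ih =>
      obtain ⟨b, rfl, hb⟩ := ih
      obtain ⟨a, c, hac, h1, h2⟩ := (edgeRel_iff hL).1 h
      rw [← Fin.ext h1] at hb
      exact ⟨c, h2, hb.tail hac⟩
  · intro h
    exact h.lift (fun x : Fin N => (x : ℕ)) fun a b hab => (edgeRel_iff hL).2 ⟨a, b, hab, rfl, rfl⟩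

/-- On a finite type the irreflexive transitive closure is well-founded. Every predecessor of a
natural number is a vertex, so numbers outside the graph are accessible too. -/
theorem wellFounded_edgeRel (hG : G.IsDAG) (hL : G.IsEdgeList L) :
    WellFounded (EdgeRel (tailOf L) (headOf L) L.length) := by
  have hT : IsTrans (Fin N) (Relation.TransGen G.Adj) := ⟨fun _ _ _ h1 h2 => h1.trans h2⟩
  have hI : Std.Irrefl (Relation.TransGen G.Adj) := ⟨hG⟩
  have hwf := Finite.wellFounded_of_trans_of_irrefl (Relation.TransGen G.Adj)
  have key : ∀ b : Fin N, Acc (EdgeRel (tailOf L) (headOf L) L.length) b := by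
    intro b
    induction b using hwf.induction with
    | _ b ih =>
    refine Acc.intro _ fun x hx => ?_
    obtain ⟨a, c, h, rfl, h2⟩ := (edgeRel_iff hL).1 hx
    rw [Fin.ext h2] at h
    exact ih a (.single h)
  refine ⟨fun y => Acc.intro _ fun x hx => ?_⟩
  obtain ⟨a, c, h, rfl, h2⟩ := (edgeRel_iff hL).1 hx
  exact key a

open WordRAM in
theorem itemCount_vertices (hL : G.IsEdgeList L) (v : Fin N) :
    itemCount (tailOf L) (headOf L) L.length id N v = (G.ancestors v).ncard := by
  classical
  rw [itemCount, ← Set.ncard_coe_finset]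
  symm
  refine Set.ncard_congr (fun u _ => (u : ℕ)) (fun u hu => ?_) (fun a b _ _ h => Fin.ext h)
    fun j hj => ?_
  · simpa using (reflTransGen_edgeRel_iff hL).2 hu
  · simp only [Finset.coe_filter, Finset.mem_range, Set.mem_ofPred_eq, id] at hj
    exact ⟨⟨j, hj.1⟩, (reflTransGen_edgeRel_iff hL (u := ⟨j, hj.1⟩)).1 hj.2, rfl⟩

open WordRAM in
theorem itemCount_edges (hL : G.IsEdgeList L) (v : Fin N) :
    itemCount (tailOf L) (headOf L) L.length (headOf L) L.length v =
      (G.ancestorEdges v).ncard := by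
  classical
  rw [itemCount, ← Set.ncard_coe_finset]
  have hmem : ∀ j, j ∈ (((Finset.range L.length).filter fun j => Relation.ReflTransGen
      (EdgeRel (tailOf L) (headOf L) L.length) (headOf L j) v : Finset ℕ) : Set ℕ) ↔
      ∃ hj : j < L.length, L[j].2 ∈ G.ancestors v := by
    intro j
    simp only [Finset.coe_filter, Finset.mem_range, Set.mem_ofPred_eq]
    constructor
    · rintro ⟨hj, h⟩
      rw [headOf_eq hj] at h
      exact ⟨hj, (reflTransGen_edgeRel_iff hL).1 h⟩
    · rintro ⟨hj, h⟩
      rw [headOf_eq hj]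
      exact ⟨hj, (reflTransGen_edgeRel_iff hL).2 h⟩
  refine Set.ncard_congr (fun j hj => L[j]'((hmem j).1 hj).1) (fun j hj => ?_)
    (fun a b ha hb h => ?_) fun e he => ?_
  · obtain ⟨hjl, h⟩ := (hmem j).1 hj
    have hadj : G.Adj L[j].1 L[j].2 := (hL.2 _ _).1 (List.getElem_mem hjl)
    -- Prefixing the edge itself to the path from its head makes the tail an ancestor.
    exact ⟨hadj, Relation.ReflTransGen.head hadj h, h⟩
  · exact (hL.1.getElem_inj_iff).1 h
  · obtain ⟨h1, h2, h3⟩ := he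
    obtain ⟨k, hk, h4⟩ := List.getElem_of_mem ((hL.2 e.1 e.2).2 h1)
    exact ⟨k, (hmem k).2 ⟨hk, by rw [h4]; exact h3⟩, h4⟩

theorem length_le_of_isEdgeList (hL : G.IsEdgeList L) : L.length ≤ N * N := by
  simpa using hL.1.length_le_card

end Graph

/-! ### The parameters -/

section Parameters

theorem log_le_size {n : ℕ} (hn : 2 ≤ n) : Real.log n ≤ n.size := by
  have h1 : (n : ℝ) < 2 ^ n.size := by exact_mod_cast Nat.lt_size_self n
  have h2 := Real.log_le_log (by positivity) h1.le
  rw [Real.log_pow] at h2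
  have h3 : Real.log 2 < 1 := by linarith [Real.log_two_lt_d9]
  have h4 : (0 : ℝ) ≤ n.size := by positivity
  nlinarith

/-- From `2 ^ (n.size - 1) ≤ n`; the missing log 2 is at most log n, and 2 / log 2 < 3. -/
theorem size_le_log {n : ℕ} (hn : 2 ≤ n) : (n.size : ℝ) ≤ 3 * Real.log n := by
  have h0 : 0 < n.size := Nat.size_pos.2 (by omega)
  have h1 : 2 ^ (n.size - 1) ≤ n := Nat.lt_size.1 (by omega)
  have h2 : ((2 : ℝ) ^ (n.size - 1)) ≤ n := by exact_mod_cast h1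
  have h3 := Real.log_le_log (by positivity) h2
  rw [Real.log_pow, Nat.cast_sub (by omega)] at h3
  have h4 : Real.log 2 ≤ Real.log n := Real.log_le_log (by norm_num) (by exact_mod_cast hn)
  have h5 := Real.log_two_gt_d9
  have h6 : (1 : ℝ) ≤ n.size := by exact_mod_cast h0
  push_cast at h3
  nlinarith

theorem two_le_size {n : ℕ} (hn : 2 ≤ n) : 2 ≤ n.size := Nat.lt_size.2 (by simpa using hn)

/-- The largest intermediate value is of order R · 2^I, which has O(log n) bits because `I` is
linear in the bit length and a·l ≤ 2^(a·l). Blocks of length 2^(3l) hold an input with up to n²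
edges since n < 2^l. -/
theorem fits_of_le {n N m D a c : ℕ} (hn : 2 ≤ n) (hN : N ≤ n) (hm : m ≤ N * N) (hc : c ≤ a) :
    WordRAM.Fits ((a + D + 10) * n.size) a (D + 3) c n N m := by
  have hl := two_le_size hn
  have hnl := Nat.lt_size_self n
  set l := n.size
  have hl2 : l < 2 ^ l := Nat.lt_two_pow_self
  have hx : 2 ^ (3 * l) = 2 ^ l * 2 ^ l * 2 ^ l := by rw [← pow_add, ← pow_add]; congr 1; ring
  have hx4 : 4 ≤ 2 ^ l := by
    calc 4 = 2 ^ 2 := by norm_num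
      _ ≤ 2 ^ l := Nat.pow_le_pow_right (by norm_num) hl
  have hmn : m ≤ n * n := hm.trans (Nat.mul_le_mul hN hN)
  refine ⟨by nlinarith, by nlinarith, ?_, hc, by omega, ?_, ?_⟩
  · have h1 : a * l ≤ 2 ^ (a * l) := Nat.lt_two_pow_self.le
    have h2 : a * l * 2 ^ ((D + 3) * l) ≤ 2 ^ (a * l + (D + 3) * l) := by
      rw [pow_add]; exact Nat.mul_le_mul_right _ h1
    have h3 : a * l ≤ 2 ^ (a * l + (D + 3) * l) :=
      h1.trans (Nat.pow_le_pow_right (by norm_num) (by omega))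
    have h4 : 2 ^ (a * l + (D + 3) * l + 3) ≤ 2 ^ ((a + D + 10) * l) :=
      Nat.pow_le_pow_right (by norm_num) (by nlinarith)
    change 2 * (a * l * 2 ^ ((D + 3) * l)) + 2 * (a * l) < _
    rw [pow_add _ _ 3] at h4
    have h5 : 0 < 2 ^ (a * l + (D + 3) * l) := by positivity
    omega
  · rw [hx]
    nlinarith [Nat.mul_le_mul hx4 hx4]
  · rw [hx]
    generalize 2 ^ l = x at *
    have h6 : (n + 1) * (n + 1) ≤ x * x := Nat.mul_le_mul hnl hnl
    have h7 : 4 * (x * x) ≤ x * x * x := by nlinarith [Nat.zero_le (x * x)]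
    nlinarith

/-- This supplies the hypothesis `ha` of `isEstimate_levelEstimate`: `D` levels cover the factor
`D`, twice the bit length covers n², and what remains absorbs the `- 1`. -/
theorem mul_le_two_pow {n D a : ℕ} (hn : 2 ≤ n) (ha : a ≤ n * n) :
    D * a ≤ 2 ^ ((D + 3) * n.size - 1) := by
  have hl := two_le_size hn
  have hnl := (Nat.lt_size_self n).le
  set l := n.size
  calc D * a ≤ 2 ^ D * (2 ^ l * 2 ^ l) :=
        Nat.mul_le_mul Nat.lt_two_pow_self.le (ha.trans (Nat.mul_le_mul hnl hnl))
    _ = 2 ^ (D + (l + l)) := by rw [pow_add, pow_add]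
    _ ≤ _ := Nat.pow_le_pow_right (by norm_num) (by
      have : D ≤ D * l := Nat.le_mul_of_pos_right _ (by omega)
      have : (D + 3) * l = D * l + 3 * l := by ring
      omega)

/-- Levels times repetitions times a linear scan. Lower-order terms are absorbed using N + m ≥ 1:
320 = 10 + 200 + 110, 1000 is 500 for each phase, and 9 is the square of the constant in
`size_le_log`. -/
theorem time_bound {n N m D a : ℕ} (hn : 2 ≤ n) (hN : 1 ≤ N) (ha : 1 ≤ a) :
    ((10 * n.size + 200 * (N + m) + 110 +
        (D + 3) * n.size * (a * n.size * (106 * N + 68 * m + 26) + 58 * N + 30) +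
        (D + 3) * n.size * (a * n.size * (116 * m + 58 * N + 26) + 58 * N + 30) : ℕ) : ℝ) ≤
      (9 * (320 + 1000 * (D + 3) * a) : ℝ) * (N + m) * Real.log n ^ 2 := by
  have hl := two_le_size hn
  have hlog := size_le_log hn
  set l := n.size
  have hX : 1 ≤ N + m := by omega
  have key : 10 * l + 200 * (N + m) + 110 +
        (D + 3) * l * (a * l * (106 * N + 68 * m + 26) + 58 * N + 30) +
        (D + 3) * l * (a * l * (116 * m + 58 * N + 26) + 58 * N + 30) ≤
      (320 + 1000 * (D + 3) * a) * (N + m) * (l * l) := by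
    have hal : 1 ≤ a * l := Nat.mul_pos ha (by omega)
    have h1 : a * l * (106 * N + 68 * m + 26) + 58 * N + 30 ≤ a * l * (500 * (N + m)) := by
      nlinarith
    have h2 : a * l * (116 * m + 58 * N + 26) + 58 * N + 30 ≤ a * l * (500 * (N + m)) := by
      nlinarith
    have h3 := Nat.mul_le_mul_left ((D + 3) * l) h1
    have h4 := Nat.mul_le_mul_left ((D + 3) * l) h2
    have h5 : l ≤ l * l := Nat.le_mul_self l
    have h6 : l * l ≤ (N + m) * (l * l) := Nat.le_mul_of_pos_left _ hX
    have h7 : N + m ≤ (N + m) * (l * l) := Nat.le_mul_of_pos_right _ (by nlinarith)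
    have h8 : (D + 3) * l * (a * l * (500 * (N + m))) =
      500 * ((D + 3) * a * ((N + m) * (l * l))) := by ring
    have h9 : (320 + 1000 * (D + 3) * a) * (N + m) * (l * l) =
      320 * ((N + m) * (l * l)) + 1000 * ((D + 3) * a * ((N + m) * (l * l))) := by ring
    rw [h8] at h3 h4
    rw [h9]
    omega
  have hll : (l : ℝ) * l ≤ 9 * Real.log n ^ 2 := by
    have : (0 : ℝ) ≤ l := by positivity
    nlinarith
  calc _ ≤ (((320 + 1000 * (D + 3) * a) * (N + m) * (l * l) : ℕ) : ℝ) := by exact_mod_cast key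
    _ = (320 + 1000 * (D + 3) * a : ℝ) * (N + m) * (l * l) := by push_cast; ring
    _ ≤ (320 + 1000 * (D + 3) * a : ℝ) * (N + m) * (9 * Real.log n ^ 2) :=
      mul_le_mul_of_nonneg_left hll (by positivity)
    _ = _ := by ring

/-- The two factors 2 stand for the two kinds of items and the two tails. Each factor in front,
including `n ^ d`, is at most an exponential of a multiple of the bit length, and `M` dominates the
sum of these multiples. -/
theorem failure_bound {n N D M : ℕ} {d : ℝ} (hn : 2 ≤ n) (hN : N ≤ n) (hd : 0 ≤ d) (hD : 0 < D)
    (hM : d + 4 * (D + 3) + 2 ≤ M) :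
    (((D + 3) * n.size * N : ℕ) : ℝ) *
      (2 * (2 * Real.exp (-2 * (1 / (D : ℝ) ^ 2) ^ 2 * ((D ^ 4 * M * n.size : ℕ) : ℝ)))) ≤
      1 / (n : ℝ) ^ d := by
  have hl := two_le_size hn
  have hlog := log_le_size hn
  set l := n.size
  have hl' : (2 : ℝ) ≤ l := by exact_mod_cast hl
  have hn0 : (0 : ℝ) < n := by positivity
  have hD0 : (0 : ℝ) < D := by exact_mod_cast hD
  have hN' : (N : ℝ) ≤ Real.exp l := by
    calc (N : ℝ) ≤ n := by exact_mod_cast hN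
      _ = Real.exp (Real.log n) := (Real.exp_log hn0).symm
      _ ≤ Real.exp l := Real.exp_le_exp.2 hlog
  have hlexp : (l : ℝ) ≤ Real.exp l := by linarith [Real.add_one_le_exp (l : ℝ)]
  have hDexp : (4 * (D + 3) : ℝ) ≤ Real.exp (4 * (D + 3) * l) := by
    have := Real.add_one_le_exp (4 * (D + 3) * l : ℝ)
    nlinarith
  have hnd : (n : ℝ) ^ d ≤ Real.exp (d * l) := by
    rw [Real.rpow_def_of_pos hn0]
    exact Real.exp_le_exp.2 (by nlinarith)
  have hexp : -2 * (1 / (D : ℝ) ^ 2) ^ 2 * ((D ^ 4 * M * l : ℕ) : ℝ) = -(2 * M * l) := by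
    push_cast; field_simp
  rw [hexp, le_div_iff₀ (by positivity)]
  calc (((D + 3) * l * N : ℕ) : ℝ) * (2 * (2 * Real.exp (-(2 * M * l)))) * (n : ℝ) ^ d
      = (4 * (D + 3) : ℝ) * l * N * (n : ℝ) ^ d * Real.exp (-(2 * M * l)) := by push_cast; ring
    _ ≤ Real.exp (4 * (D + 3) * l) * Real.exp l * Real.exp l * Real.exp (d * l) *
        Real.exp (-(2 * M * l)) := by gcongr
    _ = Real.exp ((4 * (D + 3) + 2 + d) * l - 2 * M * l) := by
      rw [← Real.exp_add, ← Real.exp_add, ← Real.exp_add, ← Real.exp_add]; congr 1; ring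
    _ ≤ 1 := by
      rw [Real.exp_le_one_iff]
      have : (0 : ℝ) ≤ M := by positivity
      nlinarith

end Parameters

/-! ### Choice of the parameters and the union bound. -/

theorem mainTheorem5 (ε d : ℝ) (hε : 0 < ε) (hd : 1 ≤ d) :
    ∃ (P : WordRAM.Prog) (c : ℕ) (C : ℝ), 0 < c ∧
      ∀ (n N : ℕ), 2 ≤ n → 1 ≤ N → N ≤ n →
      ∀ (G : Digraph (Fin N)) (L : List (Fin N × Fin N)), G.IsDAG → G.IsEdgeList L →
        (∀ ω : ℕ → Fin (2 ^ (c * Nat.size n)), ∃ (T : ℕ) (t : WordRAM.State),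
          WordRAM.Exec (c * Nat.size n) ω P
            (WordRAM.initial (c * Nat.size n) (encodeInput n N L)) T t ∧
          (T : ℝ) ≤ C * ((N : ℝ) + (L.length : ℝ)) * Real.log n ^ 2) ∧
        1 - 1 / (n : ℝ) ^ d ≤
          (WordRAM.randomWords (c * Nat.size n)).real
            {ω | ∃ (T : ℕ) (t : WordRAM.State),
              WordRAM.Exec (c * Nat.size n) ω P
                (WordRAM.initial (c * Nat.size n) (encodeInput n N L)) T t ∧
              CorrectOutput ε G t} := by
  -- `D` fixes the accuracy 1/D². The factor `D ^ 4` in the repetitions cancels its square in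
  -- Hoeffding's exponent, leaving 2M times the bit length; `b = a / D` gives the threshold.
  set D : ℕ := max 8 ⌈40 / ε⌉₊ with hD
  have hD8 : 8 ≤ D := le_max_left _ _
  have hDε : 40 / ε ≤ D := (Nat.le_ceil _).trans (by exact_mod_cast le_max_right _ _)
  set M : ℕ := ⌈d⌉₊ + 4 * (D + 3) + 2 with hM
  have hMd : d + 4 * (D + 3) + 2 ≤ M := by
    rw [hM]; push_cast; linarith [Nat.le_ceil d]
  set a : ℕ := D ^ 4 * M with ha
  set b : ℕ := D ^ 3 * M with hb
  have hab : a = D * b := by rw [ha, hb]; ring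
  have hM0 : 0 < M := by omega
  have hb0 : 0 < b := by positivity
  have ha0 : 0 < a := by positivity
  have hba : b ≤ a := by rw [hab]; exact Nat.le_mul_of_pos_left _ (by omega)
  refine ⟨WordRAM.algorithm a (D + 3) b, a + D + 10, 9 * (320 + 1000 * (D + 3) * a), by omega, ?_⟩
  intro n N hn hN1 hNn G L hG hL
  set l := n.size with hl
  have hl2 : 2 ≤ l := two_le_size hn
  set w := (a + D + 10) * l with hw
  have hm := length_le_of_isEdgeList hL
  have hf : WordRAM.Fits w a (D + 3) b n N L.length := fits_of_le hn hNn hm hba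
  have hT : ∀ k < L.length, tailOf L k < N := fun k hk => by rw [tailOf_eq hk]; exact L[k].1.2
  have hH : ∀ k < L.length, headOf L k < N := fun k hk => by rw [headOf_eq hk]; exact L[k].2.2
  have hS : 2 ^ (3 * l) ≤ 2 ^ w := Nat.pow_le_pow_right (by norm_num) (by have := hf.hw; omega)
  have hNw : N < 2 ^ w := hf.hN.trans_le hS
  have hmw : L.length < 2 ^ w := lt_of_lt_of_le (by have := hf.hm; rw [← hl] at this; omega) hS
  have hnw : n < 2 ^ w := (Nat.lt_size_self n).trans_le
    (Nat.pow_le_pow_right (by norm_num) (by have := hf.hw; omega))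
  have hrun := fun ω : ℕ → Fin (2 ^ w) => WordRAM.run_algorithm (ω := ω) hf
    (T := tailOf L) (H := headOf L) (s := WordRAM.initial w (encodeInput n N L))
    (by simp [WordRAM.initial, encodeInput, Nat.mod_eq_of_lt hnw])
    (by simp [WordRAM.initial, encodeInput, Nat.mod_eq_of_lt hNw])
    (by simp [WordRAM.initial, encodeInput, Nat.mod_eq_of_lt hmw])
    (fun k hk => by
      simp only [WordRAM.initial, getD_encodeInput_tail]
      exact Nat.mod_eq_of_lt ((hT k hk).trans hNw))
    (fun k hk => by
      simp only [WordRAM.initial, getD_encodeInput_head]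
      exact Nat.mod_eq_of_lt ((hH k hk).trans hNw))
    (fun x hx => by
      simp only [WordRAM.initial]
      rw [List.getD_eq_default _ _ (by rw [length_encodeInput]; exact hx), Nat.zero_mod])
    (fun _ => rfl) rfl hT hH (wellFounded_edgeRel hG hL)
  refine ⟨fun ω => ?_, ?_⟩
  · obtain ⟨T, t, h1, h2, -⟩ := hrun ω
    exact ⟨T, t, h1, (Nat.cast_le.2 h2).trans (time_bound hn hN1 ha0)⟩
  set I := (D + 3) * l with hI
  set R := a * l with hR
  have hR0 : 0 < R := Nat.mul_pos ha0 (by omega)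
  have hIw : I ≤ w := hf.hI
  have hI0 : 0 < I := Nat.mul_pos (by omega) (by omega)
  set bad : ℕ → (ℕ → ℕ) → ℕ → ℕ × ℕ → Set (ℕ → Fin (2 ^ w)) := fun dr own J p =>
    {ω | 1 / (D : ℝ) ^ 2 <
      |(WordRAM.hitCount ω (tailOf L) (headOf L) L.length own J R dr p.1 R p.2 : ℝ) / R -
        hitProb (WordRAM.itemCount (tailOf L) (headOf L) L.length own J p.2) p.1|} with hbad
  set Bad : Set (ℕ → Fin (2 ^ w)) := ⋃ p ∈ Finset.range I ×ˢ Finset.range N,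
    (bad 0 id N p ∪ bad (I * R * N) (headOf L) L.length p) with hBad
  have hbadle : ∀ dr own J, ∀ p ∈ Finset.range I ×ˢ Finset.range N,
      (WordRAM.randomWords w).real (bad dr own J p) ≤
        2 * Real.exp (-2 * (1 / (D : ℝ) ^ 2) ^ 2 * R) := by
    intro dr own J p hp
    rw [Finset.mem_product, Finset.mem_range] at hp
    exact WordRAM.measureReal_hitCount_deviation_le (by omega) hR0 _ _ _ _ _ _ _ (by positivity)
  have hBadle : (WordRAM.randomWords w).real Bad ≤ 1 / (n : ℝ) ^ d := by
    refine (measureReal_biUnion_finset_le _ _).trans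
      ((Finset.sum_le_card_nsmul _ _ (2 * (2 * Real.exp (-2 * (1 / (D : ℝ) ^ 2) ^ 2 * R)))
        fun p hp => ?_).trans ?_)
    · refine (measureReal_union_le _ _).trans ?_
      linarith [hbadle 0 id N p hp, hbadle (I * R * N) (headOf L) L.length p hp]
    · rw [Finset.card_product, Finset.card_range, Finset.card_range, nsmul_eq_mul]
      exact failure_bound hn hNn (by linarith) (by omega) hMd
  set Good := {ω | ∃ (T : ℕ) (t : WordRAM.State), WordRAM.Exec w ω (WordRAM.algorithm a (D + 3) b)
    (WordRAM.initial w (encodeInput n N L)) T t ∧ CorrectOutput ε G t} with hGood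
  -- Covering the space and using subadditivity avoids any measurability claim about `Good`.
  have hcover : (Set.univ : Set (ℕ → Fin (2 ^ w))) ⊆ Good ∪ Bad := by
    intro ω _
    by_cases hω : ω ∈ Bad
    · exact .inr hω
    refine .inl ?_
    obtain ⟨T, t, h1, -, h2⟩ := hrun ω
    refine ⟨T, t, h1, fun v => ?_⟩
    have hok : ∀ i < I, ω ∉ bad 0 id N (i, (v : ℕ)) ∧
        ω ∉ bad (I * R * N) (headOf L) L.length (i, (v : ℕ)) := by
      intro i hi
      rw [← not_or]
      refine fun h => hω ?_
      rw [hBad, Set.mem_iUnion₂]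
      exact ⟨(i, v), by simp [hi], h⟩
    have hthr : R = D * (b * l) := by rw [hR, hab]; ring
    have hitem : ∀ own J, WordRAM.itemCount (tailOf L) (headOf L) L.length own J v ≤ J := by
      classical
      intro own J
      exact (Finset.card_filter_le _ _).trans (by simp)
    obtain ⟨e1, e2⟩ := h2 v v.2
    rw [e1, e2, ← itemCount_vertices hL, ← itemCount_edges hL]
    constructor
    · exact isEstimate_levelEstimate hε hD8 hDε (Nat.mul_pos hb0 (by omega)) hthr hI0
        (mul_le_two_pow hn ((hitem _ _).trans (hNn.trans (Nat.le_mul_self n))))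
        fun i hi => not_lt.1 (hok i hi).1
    · exact isEstimate_levelEstimate hε hD8 hDε (Nat.mul_pos hb0 (by omega)) hthr hI0
        (mul_le_two_pow hn ((hitem _ _).trans (hm.trans (Nat.mul_le_mul hNn hNn))))
        fun i hi => not_lt.1 (hok i hi).2
  have htotal : (1 : ℝ) ≤ (WordRAM.randomWords w).real (Good ∪ Bad) := by
    rw [← probReal_univ (μ := WordRAM.randomWords w)]
    exact measureReal_mono hcover
  have := measureReal_union_le (μ := WordRAM.randomWords w) Good Bad
  linarith
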